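/- All graphs are finite, undirected, without loops or multiple edges. For a positive integer $k$, a tree is called $k$-ended if it has at most $k$ vertices of degree one. For a graph $G$ and $k\ge 2$ let $t_k$ be the largest order (number of vertices) of a $k$-ended tree contained in $G$ as a subgraph. Let $\sigma_3$ be the minimum of $d(x)+d(y)+d(z)$ over all independent sets $\{x,y,z\}$ of three vertices of $G$, with $\sigma_3=+\infty$ if there is no such set. A subgraph $T$ of $G$ is dominating if the vertices of $G$ not in $T$ form an independent set of $G$. Theorem. Let $k\ge 2$ be an integer. (1) If $G$ is a connected graph with $\sigma_3\ge t_{k+1}-2k+4$, then $G$ has a dominating $k$-ended tree. (2) The bound in (1) is sharp: for every integer $\delta\ge 2$, let $G$ be the graph $(\delta+k-1)K_2+K_{\delta-1}$, that is, the join of $\delta+k-1$ disjoint copies of $K_2$ with a complete graph on $\delta-1$ vertices. Then $G$ is connected with minimum degree $\delta$, it satisfies $\sigma_3\ge t_{k+1}-2k+3$ and $\sigma_3\ge t_k-2k+4$, and it has no dominating $k$-ended tree. -/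

import Mathlib

namespace SimpleGraph

/-- The set of end-vertices (vertices of degree one) of a subgraph `T`,
the degree being taken in `T`. -/
def Subgraph.endVerts {V : Type*} {G : SimpleGraph V} (T : G.Subgraph) : Set V :=
  {v | v ∈ T.verts ∧ (T.neighborSet v).ncard = 1}

/-- A subgraph of `G` is a `k`-ended tree if it is a tree with at most `k` end-vertices. -/
def Subgraph.IsKEndedTree {V : Type*} {G : SimpleGraph V} (T : G.Subgraph) (k : ℕ) : Prop :=
  T.coe.IsTree ∧ T.endVerts.ncard ≤ k

/-- A subgraph `T` of `G` is dominating if the vertices of `G` outside `T` are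
pairwise nonadjacent in `G`. -/
def Subgraph.IsDominatingSubgraph {V : Type*} {G : SimpleGraph V} (T : G.Subgraph) : Prop :=
  G.IsIndepSet T.vertsᶜ

/-- The order of a largest `k`-ended tree in a finite graph `G`, for `k ≥ 2`
(the orders form a bounded set of naturals; it is nonempty when `G` has a vertex). -/
noncomputable def largestKEndedTree {V : Type*} (G : SimpleGraph V) (k : ℕ) : ℕ :=
  sSup {n : ℕ | ∃ T : G.Subgraph, T.IsKEndedTree k ∧ T.verts.ncard = n}

/-- The minimum degree sum of an independent set of `k` vertices of `G`, and `⊤` if there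
is no such set. -/
noncomputable def sigma {V : Type*} [Fintype V] (G : SimpleGraph V) [DecidableRel G.Adj]
    (k : ℕ) : ℕ∞ :=
  ⨅ S : {S : Finset V // G.IsNIndepSet k S}, ((∑ v ∈ S.1, G.degree v : ℕ) : ℕ∞)

/-- The graph `m K₂ + K_s`: `m` disjoint copies of `K₂` (the vertices `inl (i, 0)` and
`inl (i, 1)` form the `i`-th copy), joined completely to a complete graph on `s` vertices. -/
def edgesJoinClique (m s : ℕ) : SimpleGraph ((Fin m × Fin 2) ⊕ Fin s) where
  Adj a b := a ≠ b ∧ ∀ p q, a = Sum.inl p → b = Sum.inl q → p.1 = q.1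
  symm := ⟨fun _ _ h => ⟨h.1.symm, fun p q hp hq => (h.2 q p hq hp).symm⟩⟩
  loopless := ⟨fun _ h => h.1 rfl⟩

instance (m s : ℕ) : DecidableRel (edgesJoinClique m s).Adj := fun a b =>
  inferInstanceAs (Decidable (a ≠ b ∧ ∀ p q, a = Sum.inl p → b = Sum.inl q → p.1 = q.1))

end SimpleGraph

/-! Part (1). Suppose no dominating `k`-ended tree exists. Every `k`-ended tree then misses an edge,
so by connectivity a path of length two can be hung on it at the cost of at most one leaf; hence
`t_k + 2 ≤ t_{k+1}` (`Connected.hasLeafGap`). Write `t` for `t_{k+1}` and take a `(k+1)`-ended tree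
of order `t`. Any change that saves a leaf and loses at most one vertex contradicts the gap. So
there are exactly `k + 1` leaves, they are independent in `G`, all their neighbours lie in the tree,
and the tree neighbour of a leaf has degree two and is `G`-adjacent to no other leaf.

Root the tree at a branch vertex `b`, with parent map `p`, and pick leaves `x₀, x₁, x₂` in three
different branches. If `v` is adjacent to some `x j` outside its own branch, rehang `v` below `x j`:
`p v` becomes a leaf of another extremal tree, so `p v` and `p (p v)` have degree two and are
adjacent to no `x i` with `i ≠ j` (`HasLeafGap.of_adj_leaf`). Extra adjacencies of `v` can therefore
be charged to `p v` and `p (p v)`. All these charges are distinct, and they avoid the `k + 1` leaves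
and the parents of the `k - 2` leaves not chosen. As `b` itself contributes at most `3`, the degree
sum is at most `(t - 1) - (2k - 1) + 3 = t - 2k + 3`, contradicting the hypothesis.

Part (2). By the handshake identity, a tree with at most `r` leaves in `m K₂ + K_s` meets at most `s
+ r - 1` copies of `K₂` (`IsTreeOn.card_touched_le`). This bounds its order by `3s + 2r - 2`, and
with `s + k` copies a `k`-ended tree misses a whole edge. -/

namespace SimpleGraph

/-! ### Trees as spanning graphs: edge exchange, deleting and adding leaves -/

section TreeOn

variable {V : Type*} {H : SimpleGraph V} {S : Set V}

/-- `H` is a tree with vertex set `S`, all other vertices being isolated in `H`. -/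
structure IsTreeOn (H : SimpleGraph V) (S : Set V) : Prop where
  acyclic : H.IsAcyclic
  mem_of_adj : ∀ {a b}, H.Adj a b → a ∈ S
  reachable : ∀ {a b}, a ∈ S → b ∈ S → H.Reachable a b
  nonempty : S.Nonempty

/-- The set of vertices of degree one. -/
def leafSet (H : SimpleGraph V) : Set V := {v | (H.neighborSet v).ncard = 1}

lemma mem_leafSet_iff {v : V} : v ∈ H.leafSet ↔ ∃ n, H.neighborSet v = {n} :=
  Set.ncard_eq_one

lemma eq_of_mem_leafSet {v a b : V} (hv : v ∈ H.leafSet) (ha : H.Adj v a) (hb : H.Adj v b) :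
    a = b := by
  obtain ⟨n, hn⟩ := mem_leafSet_iff.1 hv
  have h1 : a ∈ H.neighborSet v := ha
  have h2 : b ∈ H.neighborSet v := hb
  rw [hn] at h1 h2
  exact h1.trans h2.symm

lemma exists_adj_of_mem_leafSet {v : V} (hv : v ∈ H.leafSet) : ∃ n, H.Adj v n := by
  obtain ⟨n, hn⟩ := mem_leafSet_iff.1 hv
  exact ⟨n, by rw [← mem_neighborSet, hn]; rfl⟩

lemma exists_ne_adj_of_notMem_leafSet {v a : V} (hv : v ∉ H.leafSet) (ha : H.Adj v a) :
    ∃ n, n ≠ a ∧ H.Adj v n := by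
  by_contra! hc
  refine hv (mem_leafSet_iff.2 ⟨a, Set.eq_singleton_iff_unique_mem.2 ⟨ha, fun n hn => ?_⟩⟩)
  by_contra hne
  exact hc n hne hn

lemma mem_leafSet_congr {H' : SimpleGraph V} {v : V} (h : ∀ w, H'.Adj v w ↔ H.Adj v w) :
    v ∈ H'.leafSet ↔ v ∈ H.leafSet := by
  have : H'.neighborSet v = H.neighborSet v := Set.ext h
  simp only [leafSet, Set.mem_ofPred_eq, this]

namespace IsTreeOn

lemma mem_of_adj_right (h : H.IsTreeOn S) {a b : V} (hab : H.Adj a b) : b ∈ S :=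
  h.mem_of_adj hab.symm

lemma mem_of_reachable (h : H.IsTreeOn S) {a b : V} (hab : H.Reachable a b) (hb : b ∈ S) :
    a ∈ S := by
  obtain ⟨p⟩ := hab
  cases p with
  | nil => exact hb
  | cons hadj _ => exact h.mem_of_adj hadj

lemma mem_of_mem_leafSet (h : H.IsTreeOn S) {v : V} (hv : v ∈ H.leafSet) : v ∈ S :=
  let ⟨_, hn⟩ := exists_adj_of_mem_leafSet hv
  h.mem_of_adj hn

end IsTreeOn

/-- A walk towards `q` can be followed until it first needs the deleted edge, and at that moment it
stands at `q` or `q'`. -/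
lemma Reachable.deleteEdges_or {a q q' : V} (h : H.Reachable a q) :
    (H.deleteEdges {s(q, q')}).Reachable a q ∨ (H.deleteEdges {s(q, q')}).Reachable a q' := by
  obtain ⟨p⟩ := h
  induction p with
  | nil => exact .inl .rfl
  | @cons u v w hadj p ih =>
    by_cases he : s(u, v) = s(w, q')
    · rcases Sym2.eq_iff.1 he with ⟨rfl, rfl⟩ | ⟨rfl, rfl⟩
      · exact .inl .rfl
      · exact .inr .rfl
    · have : (H.deleteEdges {s(w, q')}).Adj u v := by simp [deleteEdges_adj, hadj, he]
      exact ih.imp this.reachable.trans this.reachable.trans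

lemma Walk.reachable_deleteEdges {x y q q' : V} (P : H.Walk x y) (hq : q ∉ P.support) :
    (H.deleteEdges {s(q, q')}).Reachable x y := by
  refine ⟨P.toDeleteEdges {s(q, q')} ?_⟩
  rintro e he rfl
  exact hq (P.fst_mem_support_of_mem_edges he)

/-- The graph obtained by replacing the edge `q q'` by the edge `x y`. -/
def exchange (H : SimpleGraph V) (q q' x y : V) : SimpleGraph V :=
  H.deleteEdges {s(q, q')} ⊔ edge x y

lemma exchange_adj {q q' x y a b : V} : (H.exchange q q' x y).Adj a b ↔
    (H.Adj a b ∧ s(a, b) ≠ s(q, q')) ∨ (s(a, b) = s(x, y) ∧ a ≠ b) := by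
  simp only [exchange, sup_adj, deleteEdges_adj, edge_adj, Set.mem_singleton_iff, ne_eq,
    Sym2.eq_iff]

lemma exchange_le {G : SimpleGraph V} {q q' x y : V} (hH : H ≤ G) (hxy : G.Adj x y) :
    H.exchange q q' x y ≤ G := by
  intro a b h
  rcases exchange_adj.1 h with h | h
  · exact hH h.1
  · rcases Sym2.eq_iff.1 h.1 with ⟨rfl, rfl⟩ | ⟨rfl, rfl⟩
    exacts [hxy, hxy.symm]

namespace IsTreeOn

lemma not_reachable_deleteEdges (h : H.IsTreeOn S) {q q' : V} (hq : H.Adj q q') :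
    ¬ (H.deleteEdges {s(q, q')}).Reachable q q' := by
  have := isAcyclic_iff_forall_adj_isBridge.1 h.acyclic hq
  exact isBridge_iff.1 this

lemma not_adj_of_reachable_deleteEdges (h : H.IsTreeOn S) {q q' x y : V} (hq : H.Adj q q')
    (hx : (H.deleteEdges {s(q, q')}).Reachable x q)
    (hy : (H.deleteEdges {s(q, q')}).Reachable y q') (hne : s(x, y) ≠ s(q, q')) :
    ¬ H.Adj x y := by
  intro hxy
  have : (H.deleteEdges {s(q, q')}).Adj x y := by simp [deleteEdges_adj, hxy, hne]
  exact h.not_reachable_deleteEdges hq (hx.symm.trans (this.reachable.trans hy))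

/-- Deleting `q q'` leaves two components, one containing `q` and `x`, the other `q'` and `y`; the
edge `x y` rejoins them without closing a cycle. -/
lemma exchange (h : H.IsTreeOn S) {q q' x y : V} (hq : H.Adj q q')
    (hx : (H.deleteEdges {s(q, q')}).Reachable x q)
    (hy : (H.deleteEdges {s(q, q')}).Reachable y q') : (H.exchange q q' x y).IsTreeOn S := by
  have hxS : x ∈ S := h.mem_of_reachable (hx.mono (deleteEdges_le _)) (h.mem_of_adj hq)
  have hyS : y ∈ S := h.mem_of_reachable (hy.mono (deleteEdges_le _)) (h.mem_of_adj_right hq)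
  have hnr : ¬ (H.deleteEdges {s(q, q')}).Reachable x y := fun hr =>
    h.not_reachable_deleteEdges hq (hx.symm.trans (hr.trans hy))
  have hxy : x ≠ y := by rintro rfl; exact hnr .rfl
  have hle : H.deleteEdges {s(q, q')} ≤ H.exchange q q' x y := le_sup_left
  refine ⟨?_, ?_, ?_, h.nonempty⟩
  · exact (h.acyclic.anti (deleteEdges_le _)).sup_edge_of_not_reachable hnr
  · intro a b hab
    rcases exchange_adj.1 hab with hab | hab
    · exact h.mem_of_adj hab.1
    · rcases Sym2.eq_iff.1 hab.1 with ⟨rfl, rfl⟩ | ⟨rfl, rfl⟩ <;> assumption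
  · have hxy' : (H.exchange q q' x y).Reachable x y :=
      (exchange_adj.2 (.inr ⟨rfl, hxy⟩) : (H.exchange q q' x y).Adj x y).reachable
    have key : ∀ a ∈ S, (H.exchange q q' x y).Reachable a q := fun a ha => by
      rcases (h.reachable ha (h.mem_of_adj hq)).deleteEdges_or (q' := q') with hr | hr
      · exact hr.mono hle
      · exact (hr.mono hle).trans ((hy.mono hle).symm.trans (hxy'.symm.trans (hx.mono hle)))
    exact fun {a b} ha hb => (key a ha).trans (key b hb).symm

lemma delete_leaf (h : H.IsTreeOn S) {w n : V} (hw : w ∈ H.leafSet) (hn : H.Adj w n) :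
    (H.deleteEdges {s(n, w)}).IsTreeOn (S \ {w}) := by
  have hiso : ∀ a, ¬ (H.deleteEdges {s(n, w)}).Adj w a := by
    intro a ha
    rw [deleteEdges_adj] at ha
    obtain rfl := eq_of_mem_leafSet hw hn ha.1
    exact ha.2 (by simp [Sym2.eq_swap])
  refine ⟨h.acyclic.anti (deleteEdges_le _), ?_, ?_, ⟨n, h.mem_of_adj_right hn, hn.ne'⟩⟩
  · intro a b hab
    refine ⟨h.mem_of_adj (deleteEdges_le _ hab), ?_⟩
    rintro rfl
    exact hiso _ hab
  · have key : ∀ a ∈ S \ {w}, (H.deleteEdges {s(n, w)}).Reachable a n := fun a ha => by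
      rcases (h.reachable ha.1 (h.mem_of_adj_right hn)).deleteEdges_or (q' := w) with hr | hr
      · exact hr
      · obtain ⟨p⟩ := hr.symm
        cases p with
        | nil => exact absurd rfl ha.2
        | cons hadj _ => exact absurd hadj (hiso _)
    exact fun {a b} ha hb => (key a ha).trans (key b hb).symm

lemma add_pendant (h : H.IsTreeOn S) {x y : V} (hx : x ∈ S) (hy : y ∉ S) :
    (H ⊔ edge x y).IsTreeOn (insert y S) := by
  have hxy : x ≠ y := by rintro rfl; exact hy hx
  have hadj : (H ⊔ edge x y).Adj x y := by simp [edge_adj, hxy]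
  refine ⟨h.acyclic.sup_edge_of_not_reachable fun hr => hy (h.mem_of_reachable hr.symm hx),
    ?_, ?_, ⟨y, Set.mem_insert _ _⟩⟩
  · intro a b hab
    rcases hab with hab | hab
    · exact .inr (h.mem_of_adj hab)
    · rcases ((edge_adj ..).1 hab).1 with ⟨rfl, rfl⟩ | ⟨rfl, rfl⟩
      exacts [.inr hx, .inl rfl]
  · have key : ∀ a ∈ insert y S, (H ⊔ edge x y).Reachable a x := by
      rintro a (rfl | ha)
      · exact hadj.symm.reachable
      · exact (h.reachable ha hx).mono le_sup_left
    exact fun {a b} ha hb => (key a ha).trans (key b hb).symm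

/-- The new leaf `y` takes the place of `x`, which now has two neighbours. -/
lemma ncard_leafSet_add_pendant_le [Finite V] (h : H.IsTreeOn S) {x y : V} (hx : x ∈ H.leafSet)
    (hy : y ∉ S) : (H ⊔ edge x y).leafSet.ncard ≤ H.leafSet.ncard := by
  have hxy : x ≠ y := by rintro rfl; exact hy (h.mem_of_mem_leafSet hx)
  have hsub : (H ⊔ edge x y).leafSet ⊆ insert y (H.leafSet \ {x}) := by
    intro v hv
    by_cases hvy : v = y
    · exact .inl hvy
    by_cases hvx : v = x
    · subst hvx
      obtain ⟨n, hn⟩ := exists_adj_of_mem_leafSet hx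
      have := eq_of_mem_leafSet hv (a := n) (b := y) (by simp [hn]) (by simp [edge_adj, hxy])
      exact absurd (this ▸ h.mem_of_adj_right hn) hy
    · refine .inr ⟨(mem_leafSet_congr fun w => ?_).1 hv, hvx⟩
      simp [edge_adj, hvx, hvy]
  refine (Set.ncard_le_ncard hsub).trans ((Set.ncard_insert_le _ _).trans ?_)
  rw [Set.ncard_sdiff_singleton_add_one hx]

/-- Appending a path of length two at a vertex of a tree creates at most one new leaf, unless the
tree is a single vertex. -/
lemma add_path [Finite V] (h : H.IsTreeOn S) {x y z : V} (hx : x ∈ S) (hy : y ∉ S)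
    (hz : z ∉ S) (hyz : y ≠ z) : ((H ⊔ edge x y) ⊔ edge y z).IsTreeOn (insert z (insert y S)) ∧
      ((H ⊔ edge x y) ⊔ edge y z).leafSet.ncard ≤ max 2 (H.leafSet.ncard + 1) := by
  have h1 := h.add_pendant hx hy
  have hxy : x ≠ y := by rintro rfl; exact hy hx
  have hxz : x ≠ z := by rintro rfl; exact hz hx
  have hz' : z ∉ insert y S := by simp [hyz.symm, hz]
  refine ⟨h1.add_pendant (Set.mem_insert _ _) hz', ?_⟩
  have hsub : ((H ⊔ edge x y) ⊔ edge y z).leafSet ⊆ insert z (insert x H.leafSet) := by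
    intro v hv
    by_cases hvz : v = z
    · exact .inl hvz
    by_cases hvx : v = x
    · exact .inr (.inl hvx)
    by_cases hvy : v = y
    · subst hvy
      exact absurd (eq_of_mem_leafSet hv (a := x) (b := z) (by simp [edge_adj, hxy, hxy.symm])
        (by simp [edge_adj, hyz])) hxz
    · refine .inr (.inr ((mem_leafSet_congr fun w => ?_).1 hv))
      simp [edge_adj, hvx, hvy, hvz]
  -- If `x` already has a neighbour, it is no new leaf and only `z` is added. Otherwise the tree is
  -- the single vertex `x`, and both `x` and `z` become leaves; hence the `max 2`.
  by_cases hne : ∃ n, H.Adj x n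
  · obtain ⟨n, hn⟩ := hne
    refine le_max_of_le_right ?_
    refine (Set.ncard_le_ncard (t := insert z H.leafSet) fun v hv => ?_).trans
      (Set.ncard_insert_le _ _)
    rcases hsub hv with hvz | rfl | hvL
    · exact .inl hvz
    · refine .inr (by_contra fun hc => ?_)
      have := eq_of_mem_leafSet hv (a := n) (b := y) (by simp [hn]) (by simp [edge_adj, hxy])
      exact hy (this ▸ h.mem_of_adj_right hn)
    · exact .inr hvL
  · refine le_max_of_le_left ?_
    have hL : H.leafSet = ∅ := by
      refine Set.eq_empty_of_forall_notMem fun v hv => ?_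
      obtain ⟨n, hn⟩ := exists_adj_of_mem_leafSet hv
      obtain ⟨p⟩ := h.reachable hx (h.mem_of_adj hn)
      cases p with
      | nil => exact hne ⟨_, hn⟩
      | cons hadj _ => exact hne ⟨_, hadj⟩
    rw [hL] at hsub
    refine (Set.ncard_le_ncard hsub).trans ((Set.ncard_insert_le _ _).trans ?_)
    simp

end IsTreeOn
end TreeOn
end SimpleGraph

namespace SimpleGraph

/-! ### Branch vertices and rooted trees -/

section TreeOn

variable {V : Type*} {H : SimpleGraph V} {S : Set V}

/-- The witnesses `m` and `q'` are the predecessor and successor of `q` on the path; as the path is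
simple, its pieces on either side of `q q'` survive deletion of that edge. -/
lemma Walk.IsPath.exists_split {x y q : V} {P : H.Walk x y} (hP : P.IsPath) (hq : q ∈ P.support)
    (hx : q ≠ x) (hy : q ≠ y) : ∃ m q', m ∈ P.support ∧ q' ∈ P.support ∧ H.Adj m q ∧ H.Adj q q' ∧
      m ≠ q' ∧ (H.deleteEdges {s(q, q')}).Reachable x q ∧
      (H.deleteEdges {s(q, q')}).Reachable y q' := by
  classical
  obtain ⟨P₁, P₂, rfl⟩ := Walk.mem_support_iff_exists_append.1 hq
  cases P₂ with
  | nil => exact absurd rfl hy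
  | @cons _ q' _ hqq' P₂ =>
    obtain ⟨P₃, rfl⟩ : ∃ P₃ : H.Walk q x, P₁ = P₃.reverse := ⟨P₁.reverse, by simp⟩
    cases P₃ with
    | nil => exact absurd rfl hx
    | @cons _ m _ hqm P₃ =>
      have hnd := hP.support_nodup
      simp only [Walk.support_append, Walk.support_reverse, Walk.support_cons,
        List.tail_cons, List.reverse_cons] at hnd
      have hm : m ∈ P₃.support := P₃.start_mem_support
      have hq' : q' ∈ P₂.support := P₂.start_mem_support
      rw [List.nodup_append, List.nodup_append] at hnd
      obtain ⟨⟨-, -, h1⟩, -, h2⟩ := hnd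
      have hmq' : m ≠ q' := h2 m (by simp [hm]) q' hq'
      have hq3 : q ∉ P₃.support := fun hc => h1 q (by simp [hc]) q (by simp) rfl
      have hq2 : q ∉ P₂.support := fun hc => h2 q (by simp) q hc rfl
      refine ⟨m, q', ?_, ?_, hqm.symm, hqq', hmq', ?_, ?_⟩
      · simp [Walk.mem_support_append_iff, hm]
      · simp [Walk.mem_support_append_iff]
      · refine (P₃.reachable_deleteEdges hq3).symm.trans (Adj.reachable ?_)
        simp only [deleteEdges_adj, hqm.symm, true_and, Set.mem_singleton_iff, Sym2.eq_iff]
        rintro (⟨rfl, rfl⟩ | ⟨rfl, -⟩)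
        · exact hqm.ne rfl
        · exact hmq' rfl
      · exact (P₂.reachable_deleteEdges hq2).symm

namespace IsTreeOn

/-- On the path between two of at least three leaves there is a branch vertex. -/
lemma exists_branch (h : H.IsTreeOn S) {x y z : V} (hx : x ∈ H.leafSet) (hy : y ∈ H.leafSet)
    (hz : z ∈ H.leafSet) (hxy : x ≠ y) (hzx : z ≠ x) (hzy : z ≠ y) :
    ∃ m q q' r, q ≠ x ∧ q ≠ y ∧ H.Adj q m ∧ H.Adj q q' ∧ H.Adj q r ∧ m ≠ q' ∧ m ≠ r ∧ r ≠ q' ∧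
      (H.deleteEdges {s(q, q')}).Reachable x q ∧ (H.deleteEdges {s(q, q')}).Reachable y q' := by
  obtain ⟨P, hP⟩ := (h.reachable (h.mem_of_mem_leafSet hx) (h.mem_of_mem_leafSet hy)).exists_isPath
  have hzP : z ∉ P.support := by
    intro hc
    obtain ⟨m, q', -, -, h1, h2, h3, -⟩ := hP.exists_split hc hzx hzy
    exact h3 (eq_of_mem_leafSet hz h1.symm h2)
  -- A walk from `z` to `x` has to step onto the path, from some `r` off it to `q` on it. Then `q`
  -- has the neighbour `r` besides its two neighbours on the path.
  obtain ⟨Q⟩ := h.reachable (h.mem_of_mem_leafSet hz) (h.mem_of_mem_leafSet hx)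
  obtain ⟨d, -, hr, hq⟩ := Q.exists_boundary_dart {v | v ∉ P.support} hzP (by simp)
  obtain ⟨⟨r, q⟩, hrq⟩ := d
  simp only [Set.mem_ofPred_eq, not_not] at hr hq
  simp only at hrq
  have hend : ∀ {a b : V} (R : H.Walk a b), a ∈ H.leafSet → a ≠ b → r ∉ R.support → q ≠ a := by
    rintro a b R ha hab hrR rfl
    cases R with
    | nil => exact hab rfl
    | cons hadj R =>
      obtain rfl := eq_of_mem_leafSet ha hadj hrq.symm
      exact hrR (by simp)
  have hqx : q ≠ x := hend P hx hxy hr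
  have hqy : q ≠ y := hend P.reverse hy hxy.symm (by simpa using hr)
  obtain ⟨m, q', hm, hq', h1, h2, h3, h4, h5⟩ := hP.exists_split hq hqx hqy
  exact ⟨m, q, q', r, hqx, hqy, h1.symm, h2, hrq.symm, h3, by rintro rfl; exact hr hm,
    by rintro rfl; exact hr hq', h4, h5⟩

/-- Joining two leaves of a tree with at least three leaves, and deleting a suitable edge, reduces
the number of leaves. -/
lemma exists_fewer_leaves [Finite V] (h : H.IsTreeOn S) {G : SimpleGraph V} (hHG : H ≤ G) {x y : V}
    (hx : x ∈ H.leafSet) (hy : y ∈ H.leafSet) (hxy : G.Adj x y) (h3 : 3 ≤ H.leafSet.ncard) :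
    ∃ H' ≤ G, H'.IsTreeOn S ∧ H'.leafSet.ncard + 1 ≤ H.leafSet.ncard := by
  obtain ⟨z, hz, hzxy⟩ : ∃ z ∈ H.leafSet, z ∉ ({x, y} : Set V) :=
    Set.exists_mem_notMem_of_ncard_lt_ncard
      (lt_of_le_of_lt (Set.ncard_insert_le x {y}) (by rw [Set.ncard_singleton]; omega))
  simp only [Set.mem_insert_iff, Set.mem_singleton_iff, not_or] at hzxy
  obtain ⟨m, q, q', r, hqx, hqy, h1, h2, h3, h4, h5, h6, h7, h8⟩ :=
    h.exists_branch hx hy hz hxy.ne hzxy.1 hzxy.2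
  refine ⟨_, exchange_le hHG hxy, h.exchange h2 h7 h8, ?_⟩
  have hnadj : ¬ H.Adj x y := h.not_adj_of_reachable_deleteEdges h2 h7 h8 (by
    simp only [ne_eq, Sym2.eq_iff]; tauto)
  -- The ends `x` and `y` gain a neighbour and stop being leaves; `q` keeps `m` and `r`. Only `q'`
  -- can become a leaf, a net loss of at least one.
  have hsub : (H.exchange q q' x y).leafSet ⊆ insert q' (H.leafSet \ {x, y}) := by
    intro v hv
    by_cases hvq' : v = q'
    · exact .inl hvq'
    have hvq : v ≠ q := by
      rintro rfl
      refine h5 (eq_of_mem_leafSet hv (exchange_adj.2 (.inl ⟨h1, ?_⟩))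
        (exchange_adj.2 (.inl ⟨h3, ?_⟩))) <;>
      · simp only [ne_eq, Sym2.eq_iff]
        tauto
    have hold : ∀ {n}, H.Adj v n → (H.exchange q q' x y).Adj v n := fun hn =>
      exchange_adj.2 (.inl ⟨hn, by simp only [ne_eq, Sym2.eq_iff]; tauto⟩)
    have hvx : v ≠ x := by
      rintro rfl
      obtain ⟨n, hn⟩ := exists_adj_of_mem_leafSet hx
      have := eq_of_mem_leafSet hv (hold hn) (exchange_adj.2 (.inr ⟨rfl, hxy.ne⟩))
      exact hnadj (this ▸ hn)
    have hvy : v ≠ y := by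
      rintro rfl
      obtain ⟨n, hn⟩ := exists_adj_of_mem_leafSet hy
      have := eq_of_mem_leafSet hv (hold hn) (exchange_adj.2 (.inr ⟨Sym2.eq_swap, hxy.ne'⟩))
      exact hnadj (this ▸ hn).symm
    refine .inr ⟨(mem_leafSet_congr fun w => ⟨fun hw => ?_, hold⟩).1 hv, by simp [hvx, hvy]⟩
    rcases exchange_adj.1 hw with hw | hw
    · exact hw.1
    · rcases Sym2.eq_iff.1 hw.1 with ⟨rfl, -⟩ | ⟨rfl, -⟩
      exacts [absurd rfl hvx, absurd rfl hvy]
  have hle := (Set.ncard_le_ncard hsub).trans (Set.ncard_insert_le _ _)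
  have hpair : ({x, y} : Set V) ⊆ H.leafSet := by
    rintro v (rfl | rfl) <;> assumption
  have := Set.ncard_sdiff_add_ncard_of_subset hpair
  rw [Set.ncard_pair hxy.ne] at this
  omega

/-- Parent function of a tree rooted at `b`. -/
lemma exists_parent (h : H.IsTreeOn S) {b : V} (hb : b ∈ S) : ∃ p : V → V,
    (∀ v ∈ S, v ≠ b → H.Adj v (p v) ∧ H.dist b v = H.dist b (p v) + 1) ∧
    ∀ v w, H.Adj v w → (v ≠ b ∧ w = p v) ∨ (w ≠ b ∧ v = p w) := by
  have hex : ∀ v, ∃ w, v ∈ S → v ≠ b → H.Adj v w ∧ H.dist b v = H.dist b w + 1 := by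
    intro v
    by_cases hv : v ∈ S ∧ v ≠ b
    · obtain ⟨P, hP⟩ := (h.reachable hv.1 hb).exists_walk_length_eq_dist
      cases P with
      | nil => exact absurd rfl hv.2
      | @cons _ w _ hadj P =>
        refine ⟨w, fun _ _ => ⟨hadj, ?_⟩⟩
        have h1 := dist_le P
        rw [Walk.length_cons] at hP
        have h2 := hadj.diff_dist_adj (u := b)
        rw [dist_comm (u := v)] at hP
        rw [dist_comm (u := w)] at h1
        omega
    · exact ⟨v, fun h1 h2 => absurd ⟨h1, h2⟩ hv⟩
  choose p hp using hex
  refine ⟨p, hp, ?_⟩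
  have key : ∀ v w, H.Adj v w → H.dist b v = H.dist b w + 1 → v ≠ b ∧ w = p v := by
    intro v w hvw hd
    have hvb : v ≠ b := by rintro rfl; simp at hd
    refine ⟨hvb, ?_⟩
    have hv := h.mem_of_adj hvw
    have hex : ∀ u, H.Adj v u → H.dist b v = H.dist b u + 1 →
        ∃ P : H.Walk v b, P.IsPath ∧ P.snd = u := by
      intro u hvu hdu
      obtain ⟨P, hP⟩ := (h.reachable (h.mem_of_adj_right hvu) hb).exists_walk_length_eq_dist
      refine ⟨P.cons hvu, Walk.isPath_of_length_eq_dist _ ?_, by simp⟩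
      rw [Walk.length_cons, hP, dist_comm, ← hdu, dist_comm]
    obtain ⟨P, hP, h1⟩ := hex w hvw hd
    obtain ⟨Q, hQ, h2⟩ := hex (p v) (hp v hv hvb).1 (hp v hv hvb).2
    have := congrArg Subtype.val
      ((h.acyclic.subsingleton_path v b).elim ⟨P, hP⟩ ⟨Q, hQ⟩)
    simp only at this
    rw [← h1, ← h2, this]
  intro v w hvw
  have := h.acyclic.dist_eq_dist_add_one_of_adj_of_reachable b hvw
    (h.reachable hb (h.mem_of_adj hvw))
  rcases this with hd | hd
  · exact .inl (key v w hvw hd)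
  · exact .inr (key w v hvw.symm hd)

end IsTreeOn

/-- A tree `H` on `S` rooted at `b`, with its parent function `p` and the function `c`
sending a vertex to the child of the root above it. -/
structure IsRootedTree (H : SimpleGraph V) (S : Set V) (b : V) (p c : V → V) : Prop where
  isTreeOn : H.IsTreeOn S
  root_mem : b ∈ S
  adj_parent : ∀ {v}, v ∈ S → v ≠ b → H.Adj v (p v)
  dist_eq : ∀ {v}, v ∈ S → v ≠ b → H.dist b v = H.dist b (p v) + 1
  of_adj : ∀ {v w}, H.Adj v w → (v ≠ b ∧ w = p v) ∨ (w ≠ b ∧ v = p w)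
  branch_of_parent_eq : ∀ {v}, v ∈ S → v ≠ b → p v = b → c v = v
  branch_parent : ∀ {v}, v ∈ S → v ≠ b → p v ≠ b → c (p v) = c v

lemma IsTreeOn.exists_isRootedTree (h : H.IsTreeOn S) {b : V} (hb : b ∈ S) :
    ∃ p c, H.IsRootedTree S b p c := by
  obtain ⟨p, hp, hadj⟩ := h.exists_parent hb
  -- The ancestor at depth one is reached after `H.dist b v - 1` parent steps.
  refine ⟨p, fun v => p^[H.dist b v - 1] v, h, hb, fun hv hvb => (hp _ hv hvb).1,
    fun hv hvb => (hp _ hv hvb).2, fun hvw => hadj _ _ hvw, ?_, ?_⟩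
  · intro v hv hvb hpv
    simp [(hp v hv hvb).2, hpv]
  · intro v hv hvb hpv
    obtain ⟨h1, h2⟩ := hp v hv hvb
    have h3 := (hp (p v) (h.mem_of_adj_right h1) hpv).2
    simp [h2, h3]

namespace IsRootedTree

variable {b : V} {p c : V → V}

lemma parent_mem (h : H.IsRootedTree S b p c) {v : V} (hv : v ∈ S) (hvb : v ≠ b) : p v ∈ S :=
  h.isTreeOn.mem_of_adj_right (h.adj_parent hv hvb)

/-- A vertex which is not a descendant of `v` is connected to the parent of `v` after deletion of
the edge above `v`. -/
lemma reachable_parent (h : H.IsRootedTree S b p c) {u v : V} (hu : u ∈ S)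
    (hv : v ∈ S) (hvb : v ≠ b) (huv : c u ≠ c v) :
    (H.deleteEdges {s(v, p v)}).Reachable u (p v) := by
  -- Climb to the root by parents. Lying in another branch, or being less deep than `v`, passes from
  -- `a` to `p a` until the root, and either one keeps the climb away from `v`, hence from the
  -- deleted edge.
  have key : ∀ n, ∀ a ∈ S, H.dist b a = n → (a = b ∨ c a ≠ c v ∨ H.dist b a < H.dist b v) →
      (H.deleteEdges {s(v, p v)}).Reachable a b := by
    intro n
    induction n with
    | zero =>
      intro a ha hd _
      rw [(h.isTreeOn.reachable h.root_mem ha).dist_eq_zero_iff] at hd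
      rw [hd]
    | succ n ih =>
      intro a ha hd hor
      by_cases hab : a = b
      · rw [hab]
      have h1 := h.dist_eq ha hab
      have h2 := h.dist_eq hv hvb
      have hav : a ≠ v := by
        rintro rfl
        rcases hor with hor | hor | hor
        exacts [hab hor, hor rfl, absurd hor (lt_irrefl _)]
      refine (Adj.reachable (v := p a) ?_).trans
        (ih _ (h.parent_mem ha hab) (by omega) ?_)
      · simp only [deleteEdges_adj, h.adj_parent ha hab, Set.mem_singleton_iff, Sym2.eq_iff,
          true_and]
        rintro (⟨h3, -⟩ | ⟨h3, h4⟩)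
        · exact hav h3
        · rw [h4, h3] at h1
          omega
      · by_cases hpab : p a = b
        · exact .inl hpab
        rcases hor with hor | hor | hor
        · exact absurd hor hab
        · exact .inr (.inl (by rwa [h.branch_parent ha hab hpab]))
        · exact .inr (.inr (by omega))
  exact (key _ u hu rfl (.inr (.inl huv))).trans
    (key _ _ (h.parent_mem hv hvb) rfl (.inr (.inr (by have := h.dist_eq hv hvb; omega)))).symm

lemma branch_eq_of_adj_root (h : H.IsRootedTree S b p c) {n : V} (hn : H.Adj b n) :
    n ≠ b ∧ c n = n := by
  rcases h.of_adj hn with h1 | h1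
  · exact absurd rfl h1.1
  · exact ⟨h1.1, h.branch_of_parent_eq (h.isTreeOn.mem_of_adj_right hn) h1.1 h1.2.symm⟩

/-- Every branch at the root contains a leaf. -/
lemma exists_leaf (h : H.IsRootedTree S b p c) [Finite V] {n : V} (hn : H.Adj b n) :
    ∃ u ∈ H.leafSet, u ≠ b ∧ c u = n := by
  obtain ⟨hnb, hcn⟩ := h.branch_eq_of_adj_root hn
  -- A deepest vertex of the branch has no child, so its parent is its only neighbour.
  obtain ⟨u, ⟨huS, hub, hcu⟩, hmax⟩ := Set.exists_max_image {v | v ∈ S ∧ v ≠ b ∧ c v = n}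
    (H.dist b) (Set.toFinite _) ⟨n, h.isTreeOn.mem_of_adj_right hn, hnb, hcn⟩
  refine ⟨u, mem_leafSet_iff.2 ⟨p u, Set.eq_singleton_iff_unique_mem.2
    ⟨h.adj_parent huS hub, fun w hw => ?_⟩⟩, hub, hcu⟩
  rcases h.of_adj hw with h1 | ⟨h1, h2⟩
  · exact h1.2
  · have hwS := h.isTreeOn.mem_of_adj_right hw
    have h3 := h.dist_eq hwS h1
    have h4 := h.branch_parent hwS h1 (h2 ▸ hub)
    rw [← h2] at h3 h4
    have := hmax w ⟨hwS, h1, h4.symm.trans hcu⟩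
    omega

lemma parent_ne_child (h : H.IsRootedTree S b p c) {v : V} (hv : v ∈ S) (hvb : v ≠ b)
    (hpb : p v ≠ b) : p (p v) ≠ v := by
  intro hc
  have h1 := h.dist_eq hv hvb
  have h2 := h.dist_eq (h.parent_mem hv hvb) hpb
  rw [hc] at h2
  omega

lemma parent_notMem_leafSet (h : H.IsRootedTree S b p c) {v : V} (hv : v ∈ S) (hvb : v ≠ b)
    (hb : b ∉ H.leafSet) : p v ∉ H.leafSet := by
  intro hc
  by_cases hpb : p v = b
  · exact hb (hpb ▸ hc)
  · exact h.parent_ne_child hv hvb hpb (eq_of_mem_leafSet hc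
      (h.adj_parent (h.parent_mem hv hvb) hpb) (h.adj_parent hv hvb).symm)

/-- A vertex of degree two other than the root has a unique child. -/
lemma eq_of_parent_eq (h : H.IsRootedTree S b p c) [Finite V] {v w : V} (hv : v ∈ S)
    (hvb : v ≠ b) (hw : w ∈ S) (hwb : w ≠ b) (hpb : p v ≠ b)
    (hdeg : (H.neighborSet (p v)).ncard = 2) (heq : p v = p w) : v = w := by
  by_contra hne
  have hsub : ({v, w, p (p v)} : Set V) ⊆ H.neighborSet (p v) := by
    rintro a (rfl | rfl | rfl)
    · exact (h.adj_parent hv hvb).symm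
    · rw [heq]; exact (h.adj_parent hw hwb).symm
    · exact h.adj_parent (h.parent_mem hv hvb) hpb
  have h1 := Set.ncard_le_ncard hsub
  rw [Set.ncard_eq_three.2 ⟨v, w, p (p v), hne, (h.parent_ne_child hv hvb hpb).symm, ?_, rfl⟩] at h1
  · omega
  · rw [heq]; exact (h.parent_ne_child hw hwb (heq ▸ hpb)).symm

end IsRootedTree
end TreeOn
end SimpleGraph

namespace SimpleGraph

/-! ### Consequences of the gap for extremal trees -/

section LeafGap

variable {V : Type*} {G H : SimpleGraph V} {S : Set V} {k t : ℕ}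

/-- Trees in `G` with at most `k + 1` leaves have order at most `t`, and those with at most `k`
leaves have order at most `t - 2`. -/
structure HasLeafGap (G : SimpleGraph V) (k t : ℕ) : Prop where
  two_le : 2 ≤ k
  le : ∀ {H : SimpleGraph V} {S : Set V}, H ≤ G → H.IsTreeOn S → H.leafSet.ncard ≤ k + 1 →
    S.ncard ≤ t
  gap : ∀ {H : SimpleGraph V} {S : Set V}, H ≤ G → H.IsTreeOn S → H.leafSet.ncard ≤ k →
    S.ncard + 2 ≤ t

namespace HasLeafGap

variable [Finite V]

/-- Otherwise joining the two leaves and cutting at a branch vertex gives at most `k` leaves on the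
same vertex set. The slack `t ≤ S.ncard + 1` lets this apply also after one leaf has been deleted.
-/
lemma not_adj_of_mem_leafSet (hG : G.HasLeafGap k t) (hHG : H ≤ G) (h : H.IsTreeOn S)
    (hL : H.leafSet.ncard ≤ k + 1) (ht : t ≤ S.ncard + 1) {x y : V} (hx : x ∈ H.leafSet)
    (hy : y ∈ H.leafSet) : ¬ G.Adj x y := by
  intro hxy
  have hk := hG.two_le
  by_cases hL' : H.leafSet.ncard ≤ k
  · have := hG.gap hHG h hL'
    omega
  · obtain ⟨H', hH', h', hlt⟩ := h.exists_fewer_leaves hHG hx hy hxy (by omega)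
    have := hG.gap hH' h' (by omega)
    omega

/-- A neighbour outside could be appended at the leaf, giving a larger tree with no more leaves. -/
lemma neighborSet_leaf_subset (hG : G.HasLeafGap k t) (hHG : H ≤ G) (h : H.IsTreeOn S)
    (hL : H.leafSet.ncard ≤ k + 1) (ht : t ≤ S.ncard) {x y : V} (hx : x ∈ H.leafSet)
    (hxy : G.Adj x y) : y ∈ S := by
  by_contra hy
  have h1 := hG.le (sup_le hHG (by rwa [edge_le_iff, or_iff_right hxy.ne]))
    (h.add_pendant (h.mem_of_mem_leafSet hx) hy) ((h.ncard_leafSet_add_pendant_le hx hy).trans hL)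
  rw [Set.ncard_insert_of_notMem hy] at h1
  omega

/-- Delete the leaf `w`. Unless `q` becomes a leaf, at most `k` leaves remain on `t - 1` vertices,
against the gap. So `q` is a leaf of the smaller tree, whose leaves are still independent in `G`. -/
lemma ncard_neighborSet_adj_leaf (hG : G.HasLeafGap k t) (hHG : H ≤ G) (h : H.IsTreeOn S)
    (hL : H.leafSet.ncard ≤ k + 1) (ht : t ≤ S.ncard) {w q : V} (hw : w ∈ H.leafSet)
    (hwq : H.Adj w q) : (H.neighborSet q).ncard = 2 ∧
      ∀ w' ∈ H.leafSet, w' ≠ w → ¬ G.Adj q w' := by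
  have h' := h.delete_leaf hw hwq
  set H' := H.deleteEdges {s(q, w)} with hH'
  have hle : H' ≤ H := deleteEdges_le _
  have hwS := h.mem_of_mem_leafSet hw
  have hcard := Set.ncard_sdiff_singleton_add_one hwS
  have hcardL := Set.ncard_sdiff_singleton_add_one hw
  have hcardN := Set.ncard_sdiff_singleton_add_one (show w ∈ H.neighborSet q from hwq.symm)
  have hN : H'.neighborSet q = H.neighborSet q \ {w} := by
    ext v
    simp only [mem_neighborSet, hH', deleteEdges_adj, Set.mem_singleton_iff, Set.mem_sdiff,
      Sym2.eq_iff, true_and]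
    refine and_congr_right fun hqv => not_congr ⟨?_, .inl⟩
    rintro (h1 | ⟨h1, h2⟩)
    exacts [h1, absurd h1 hwq.ne']
  have hother : ∀ {v}, v ≠ q → v ≠ w → (v ∈ H'.leafSet ↔ v ∈ H.leafSet) := fun hvq hvw =>
    mem_leafSet_congr fun a => by simp [hH', deleteEdges_adj, hvq, hvw]
  have hw' : w ∉ H'.leafSet := fun hc => (h'.mem_of_mem_leafSet hc).2 rfl
  have hdeg : (H.neighborSet q).ncard = 2 := by
    by_contra hne
    have hsub : H'.leafSet ⊆ H.leafSet \ {w} := by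
      intro v hv
      have hvw : v ≠ w := by rintro rfl; exact hw' hv
      refine ⟨(hother ?_ hvw).1 hv, hvw⟩
      rintro rfl
      have : (H'.neighborSet v).ncard = 1 := hv
      rw [hN] at this
      omega
    have := Set.ncard_le_ncard hsub
    have := hG.gap (hle.trans hHG) h' (by omega)
    omega
  refine ⟨hdeg, fun w' hmem hne => ?_⟩
  have hsub : H'.leafSet ⊆ insert q (H.leafSet \ {w}) := by
    intro v hv
    by_cases hvq : v = q
    · exact .inl hvq
    have hvw : v ≠ w := by rintro rfl; exact hw' hv
    exact .inr ⟨(hother hvq hvw).1 hv, hvw⟩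
  have hle' := (Set.ncard_le_ncard hsub).trans (Set.ncard_insert_le _ _)
  have hw'q : w' ≠ q := by
    rintro rfl
    have : (H.neighborSet w').ncard = 1 := hmem
    omega
  have hq : q ∈ H'.leafSet := by
    change (H'.neighborSet q).ncard = 1
    rw [hN]
    omega
  exact hG.not_adj_of_mem_leafSet (hle.trans hHG) h' (by omega) (by omega) hq
    ((hother hw'q hne).2 hmem)

/-- Rehanging a vertex `v` with parent `p` below a leaf `u` to which it is adjacent in `G`. -/
lemma of_adj_leaf (hG : G.HasLeafGap k t) (hHG : H ≤ G) (h : H.IsTreeOn S)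
    (hL : H.leafSet.ncard ≤ k + 1) (ht : t ≤ S.ncard) {u v p : V} (hu : u ∈ H.leafSet)
    (hp : p ∉ H.leafSet) (hvp : H.Adj v p)
    (hup : (H.deleteEdges {s(v, p)}).Reachable u p) (huv : G.Adj u v) :
    ((H.neighborSet p).ncard = 2 ∧ ∀ u' ∈ H.leafSet, u' ≠ u → ¬ G.Adj p u') ∧
    ∃ q, q ≠ v ∧ H.Adj p q ∧ (q ≠ u → (H.neighborSet q).ncard = 2 ∧
      ∀ u' ∈ H.leafSet, u' ≠ u → ¬ G.Adj q u') := by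
  have hv : v ∉ H.leafSet := fun hv =>
    hG.not_adj_of_mem_leafSet hHG h hL (by omega) hu hv huv
  have hpu : p ≠ u := by rintro rfl; exact hp hu
  have h' : (H.exchange v p v u).IsTreeOn S := h.exchange hvp .rfl hup
  have hHG' : H.exchange v p v u ≤ G := exchange_le hHG huv.symm
  have hnadj : ¬ H.Adj v u := h.not_adj_of_reachable_deleteEdges hvp .rfl hup (by
    simp only [ne_eq, Sym2.eq_iff]
    rintro (⟨-, h1⟩ | ⟨h1, -⟩)
    exacts [hpu h1.symm, hvp.ne h1])
  set H' := H.exchange v p v u with hH'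
  have hvp' := hvp.ne
  have huv' := huv.ne
  have hnew : H'.Adj v u := exchange_adj.2 (.inr ⟨rfl, huv.ne'⟩)
  have hu' : u ∉ H'.leafSet := by
    intro hc
    obtain ⟨n, hn⟩ := exists_adj_of_mem_leafSet hu
    have hnv : n ≠ v := by rintro rfl; exact hnadj hn.symm
    refine hnv (eq_of_mem_leafSet hc (exchange_adj.2 (.inl ⟨hn, ?_⟩)) hnew.symm)
    simp only [ne_eq, Sym2.eq_iff]
    tauto
  have hv' : v ∉ H'.leafSet := by
    intro hc
    obtain ⟨n, hnp, hn⟩ := exists_ne_adj_of_notMem_leafSet hv hvp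
    have hnu : n ≠ u := by rintro rfl; exact hnadj hn
    refine hnu (eq_of_mem_leafSet hc (exchange_adj.2 (.inl ⟨hn, ?_⟩)) hnew)
    simp only [ne_eq, Sym2.eq_iff]
    tauto
  have hN : ∀ {a}, a ≠ u → a ≠ v → a ≠ p → ∀ w, H'.Adj a w ↔ H.Adj a w := by
    intro a hau hav hap w
    rw [hH', exchange_adj]
    simp only [ne_eq, Sym2.eq_iff]
    tauto
  have hNp : H'.neighborSet p = H.neighborSet p \ {v} := by
    ext w
    simp only [mem_neighborSet, hH', exchange_adj, Set.mem_sdiff, Set.mem_singleton_iff, ne_eq,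
      Sym2.eq_iff]
    have := hvp.ne'
    tauto
  have hcardL := Set.ncard_sdiff_singleton_add_one hu
  have hcardN := Set.ncard_sdiff_singleton_add_one (show v ∈ H.neighborSet p from hvp.symm)
  -- The exchange destroys the leaf `u` and can create only `p`; if it did not create `p`, at most
  -- `k` leaves would span all of `S`.
  have hdeg : (H.neighborSet p).ncard = 2 := by
    by_contra hne
    have hsub : H'.leafSet ⊆ H.leafSet \ {u} := by
      intro a ha
      have hau : a ≠ u := by rintro rfl; exact hu' ha
      have hav : a ≠ v := by rintro rfl; exact hv' ha
      refine ⟨(mem_leafSet_congr (hN hau hav ?_)).1 ha, hau⟩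
      rintro rfl
      have : (H'.neighborSet a).ncard = 1 := ha
      rw [hNp] at this
      omega
    have := Set.ncard_le_ncard hsub
    have := hG.gap hHG' h' (by omega)
    omega
  have hp' : p ∈ H'.leafSet := by
    change (H'.neighborSet p).ncard = 1
    rw [hNp]
    omega
  have hsub : H'.leafSet ⊆ insert p (H.leafSet \ {u}) := by
    intro a ha
    by_cases hap : a = p
    · exact .inl hap
    have hau : a ≠ u := by rintro rfl; exact hu' ha
    have hav : a ≠ v := by rintro rfl; exact hv' ha
    exact .inr ⟨(mem_leafSet_congr (hN hau hav hap)).1 ha, hau⟩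
  have hL' : H'.leafSet.ncard ≤ k + 1 := by
    have := (Set.ncard_le_ncard hsub).trans (Set.ncard_insert_le _ _)
    omega
  have hmem : ∀ u' ∈ H.leafSet, u' ≠ u → u' ∈ H'.leafSet ∧ u' ≠ p := by
    intro u' h1 h2
    have hu'p : u' ≠ p := by rintro rfl; exact hp h1
    have hu'v : u' ≠ v := by rintro rfl; exact hv h1
    exact ⟨(mem_leafSet_congr (hN h2 hu'v hu'p)).2 h1, hu'p⟩
  refine ⟨⟨hdeg, fun u' h1 h2 =>
    hG.not_adj_of_mem_leafSet hHG' h' hL' (by omega) hp' (hmem u' h1 h2).1⟩, ?_⟩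
  -- The new tree is again extremal with leaf `p`, so its neighbour `q` there obeys the rule for
  -- neighbours of leaves. For `q ≠ u` the exchange does not affect the neighbours of `q`.
  obtain ⟨q, hq⟩ := exists_adj_of_mem_leafSet hp'
  have hq1 : q ∈ H.neighborSet p \ {v} := hNp ▸ hq
  obtain ⟨h1, h2⟩ := hG.ncard_neighborSet_adj_leaf hHG' h' hL' ht hp' hq
  refine ⟨q, hq1.2, hq1.1, fun hqu => ⟨?_, fun u' h3 h4 => h2 u' (hmem u' h3 h4).1
    (hmem u' h3 h4).2⟩⟩
  rwa [show H'.neighborSet q = H.neighborSet q from Set.ext (hN hqu hq1.2 hq1.1.ne')] at h1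

end HasLeafGap
end LeafGap
end SimpleGraph

namespace SimpleGraph

/-! ### The degree sum of three leaves -/

section Counting

variable {V : Type*} {G H : SimpleGraph V} {S : Set V} {k t : ℕ}

/-- Assigns to each branch the index of the chosen leaf in it. For a branch without a chosen leaf
the value `0` is arbitrary: the other two indices are foreign in either case. -/
lemma exists_index_of_injective {α : Type*} {m : Fin 3 → α} (hm : m.Injective) :
    ∃ ν : α → Fin 3, ∀ a j, j ≠ ν a → m j ≠ a := by
  have : ∀ a, ∃ i, ∀ j, j ≠ i → m j ≠ a := by
    intro a
    by_cases ha : ∃ i, m i = a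
    · obtain ⟨i, rfl⟩ := ha
      exact ⟨i, fun j hj hc => hj (hm hc)⟩
    · exact ⟨0, fun j _ hc => ha ⟨j, hc⟩⟩
  choose ν hν using this
  exact ⟨ν, hν⟩

/-- Splits the number of chosen leaves adjacent to a vertex into own-branch leaf, at least one
other, and both others, matching the sets `A₀`, `A₁`, `A₂` below. -/
lemma sum_ite_fin_three_le (P : Fin 3 → Prop) [DecidablePred P] (i : Fin 3) :
    (∑ j, if P j then 1 else 0) ≤ (if P i then 1 else 0) + (if ∃ j, j ≠ i ∧ P j then 1 else 0) +
      (if ∀ j, j ≠ i → P j then 1 else 0) := by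
  rw [Fin.sum_univ_three]
  fin_cases i <;> simp only [Fin.exists_fin_succ, Fin.forall_fin_succ] <;>
    by_cases h0 : P 0 <;> by_cases h1 : P 1 <;> by_cases h2 : P 2 <;>
    simp [h0, h1, h2]

lemma exists_ne_ne_fin_three (i j : Fin 3) : ∃ l, l ≠ i ∧ l ≠ j := by
  revert i j; decide

/-- The key degree estimate: three leaves in different branches of a largest tree with `k + 1`
leaves have small degree sum. -/
theorem HasLeafGap.exists_leaves_sum_degree_le [Fintype V] (hG : G.HasLeafGap k t) (hHG : H ≤ G)
    (h : H.IsTreeOn S) (hL : H.leafSet.ncard ≤ k + 1) (ht : t ≤ S.ncard) :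
    ∃ x : Fin 3 → V, x.Injective ∧ (∀ i, x i ∈ H.leafSet) ∧
      ∑ i, (G.neighborSet (x i)).ncard + 2 * k ≤ t + 3 := by
  classical
  have hk := hG.two_le
  have hSt := hG.le hHG h hL
  have hLk : H.leafSet.ncard = k + 1 := by
    by_contra hne
    have := hG.gap hHG h (by omega)
    omega
  have hind : ∀ {a b}, a ∈ H.leafSet → b ∈ H.leafSet → ¬ G.Adj a b := fun ha hb =>
    hG.not_adj_of_mem_leafSet hHG h hL (by omega) ha hb
  -- a branch vertex, three neighbours of it, and leaves beyond them
  obtain ⟨x₀, hx₀, y₀, hy₀, z₀, hz₀, hxy₀, hxz₀, hyz₀⟩ :=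
    (Set.two_lt_ncard (s := H.leafSet)).1 (by omega)
  obtain ⟨m₀, b, m₁, m₂, -, -, hm₀, hm₁, hm₂, h01, h02, h21, -⟩ :=
    h.exists_branch hx₀ hy₀ hz₀ hxy₀ hxz₀.symm hyz₀.symm
  have hbdeg : 3 ≤ (H.neighborSet b).ncard := by
    rw [← Set.ncard_eq_three.2 ⟨m₀, m₁, m₂, h01, h02, h21.symm, rfl⟩]
    refine Set.ncard_le_ncard ?_
    rintro a (rfl | rfl | rfl) <;> assumption
  have hbL : b ∉ H.leafSet := fun hc => by
    have : (H.neighborSet b).ncard = 1 := hc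
    omega
  have hbS := h.mem_of_adj hm₀
  obtain ⟨p, c, hr⟩ := h.exists_isRootedTree hbS
  obtain ⟨m, hm, hmb⟩ : ∃ m : Fin 3 → V, m.Injective ∧ ∀ i, H.Adj b (m i) := by
    refine ⟨![m₀, m₁, m₂], ?_, ?_⟩
    · intro i j hij
      fin_cases i <;> fin_cases j <;> simp_all [eq_comm]
    · intro i
      fin_cases i <;> simpa
  choose x hxL hxb hcx using fun i => hr.exists_leaf (hmb i)
  have hxinj : x.Injective := fun i j hij => hm (by rw [← hcx, ← hcx, hij])
  have hxS : ∀ i, x i ∈ S := fun i => h.mem_of_mem_leafSet (hxL i)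
  obtain ⟨ν, hν⟩ := exists_index_of_injective hm
  have hpL : ∀ {v}, v ∈ S → v ≠ b → p v ∉ H.leafSet := fun hv hvb =>
    hr.parent_notMem_leafSet hv hvb hbL
  have hdegb : ∀ {v}, (H.neighborSet v).ncard = 2 → v ≠ b := by
    rintro v hv rfl
    omega
  have hdegL : ∀ {v}, (H.neighborSet v).ncard = 2 → v ∉ H.leafSet := by
    intro v hv hc
    have : (H.neighborSet v).ncard = 1 := hc
    omega
  -- consequences of an adjacency to a leaf in a different branch
  have hfor : ∀ {v j}, v ∈ S → v ≠ b → j ≠ ν (c v) → G.Adj (x j) v →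
      ((H.neighborSet (p v)).ncard = 2 ∧ ∀ i, i ≠ j → ¬ G.Adj (x i) (p v)) ∧
      ((H.neighborSet (p (p v))).ncard = 2 ∧ ∀ i, i ≠ j → ¬ G.Adj (x i) (p (p v))) := by
    intro v j hv hvb hj hadj
    have hreach := hr.reachable_parent (hxS j) hv hvb (by rw [hcx]; exact hν _ _ hj)
    obtain ⟨⟨h1, h2⟩, q, hqv, hq, h3⟩ := hG.of_adj_leaf hHG h hL ht (hxL j) (hpL hv hvb)
      (hr.adj_parent hv hvb) hreach hadj
    have hpb := hdegb h1
    have hpS := hr.parent_mem hv hvb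
    obtain rfl : q = p (p v) := by
      rcases hr.of_adj hq with h4 | h4
      · exact h4.2
      · exact absurd (hr.eq_of_parent_eq hv hvb (h.mem_of_adj_right hq) h4.1 hpb h1 h4.2).symm hqv
    obtain ⟨h4, h5⟩ := h3 (by intro hc; exact hpL hpS hpb (hc ▸ hxL j))
    exact ⟨⟨h1, fun i hi hc => h2 _ (hxL i) (hxinj.ne hi) hc.symm⟩,
      ⟨h4, fun i hi hc => h5 _ (hxL i) (hxinj.ne hi) hc.symm⟩⟩
  set F : Finset V := S.toFinset.erase b with hF
  have hFmem : ∀ {v}, v ∈ F ↔ v ≠ b ∧ v ∈ S := by simp [hF]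
  set A₀ := F.filter fun v => G.Adj (x (ν (c v))) v with hA₀
  set A₁ := F.filter fun v => ∃ j, j ≠ ν (c v) ∧ G.Adj (x j) v with hA₁
  set A₂ := F.filter fun v => ∀ j, j ≠ ν (c v) → G.Adj (x j) v with hA₂
  have h₁ : ∀ {v}, v ∈ A₁ → v ∈ S ∧ v ≠ b ∧ v ∉ H.leafSet ∧ (H.neighborSet (p v)).ncard = 2 ∧
      (H.neighborSet (p (p v))).ncard = 2 ∧ p v ∉ A₀ ∧ p (p v) ∉ A₀ := by
    intro v hv
    rw [hA₁, Finset.mem_filter, hFmem] at hv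
    obtain ⟨⟨hvb, hvS⟩, j, hj, hadj⟩ := hv
    obtain ⟨⟨h1, h2⟩, h3, h4⟩ := hfor hvS hvb hj hadj
    have hc1 := hr.branch_parent hvS hvb (hdegb h1)
    have hc2 := hr.branch_parent (hr.parent_mem hvS hvb) (hdegb h1) (hdegb h3)
    refine ⟨hvS, hvb, fun hc => hind (hxL j) hc hadj, h1, h3, fun hc => ?_, fun hc => ?_⟩
    · rw [hA₀, Finset.mem_filter, hc1] at hc
      exact h2 _ hj.symm hc.2
    · rw [hA₀, Finset.mem_filter, hc2, hc1] at hc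
      exact h4 _ hj.symm hc.2
  have h₂ : ∀ {v}, v ∈ A₂ → v ∈ A₁ ∧ p v ∉ A₁ := by
    intro v hv
    rw [hA₂, Finset.mem_filter] at hv
    obtain ⟨hvF, hall⟩ := hv
    obtain ⟨hvb, hvS⟩ := hFmem.1 hvF
    constructor
    · obtain ⟨j, hj, -⟩ := exists_ne_ne_fin_three (ν (c v)) 0
      exact Finset.mem_filter.2 ⟨hvF, j, hj, hall j hj⟩
    -- Each foreign neighbour `x j` of `v` excludes adjacency of `p v` to every `x i` with `i ≠ j`;
    -- having two such `j` excludes all three.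
    · rintro hc
      rw [hA₁, Finset.mem_filter] at hc
      obtain ⟨-, i, -, hi⟩ := hc
      obtain ⟨j, hj, hji⟩ := exists_ne_ne_fin_three (ν (c v)) i
      exact (hfor hvS hvb hj (hall j hj)).1.2 i hji.symm hi
  -- the parents of the other leaves
  set L := H.leafSet.toFinset with hLdef
  set W := L \ Finset.univ.image x with hW
  have hWmem : ∀ {w}, w ∈ W → w ∈ H.leafSet ∧ w ∈ S ∧ w ≠ b ∧ (H.neighborSet (p w)).ncard = 2 ∧
      ∀ i, ¬ G.Adj (x i) (p w) := by
    intro w hw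
    simp only [hW, hLdef, Finset.mem_sdiff, Set.mem_toFinset, Finset.mem_image, Finset.mem_univ,
      true_and, not_exists] at hw
    have hwb : w ≠ b := by rintro rfl; exact hbL hw.1
    have hwS := h.mem_of_mem_leafSet hw.1
    obtain ⟨h1, h2⟩ := hG.ncard_neighborSet_adj_leaf hHG h hL ht hw.1 (hr.adj_parent hwS hwb)
    exact ⟨hw.1, hwS, hwb, h1, fun i hc => h2 _ (hxL i) (hw.2 i) hc.symm⟩
  have hLcard : L.card = k + 1 := by rw [← hLk, Set.ncard_eq_toFinset_card']
  have hWcard : W.card + 3 = k + 1 := by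
    have hsub : Finset.univ.image x ⊆ L := by
      intro v hv
      obtain ⟨i, -, rfl⟩ := Finset.mem_image.1 hv
      simpa [hLdef] using hxL i
    have h1 := Finset.card_sdiff_add_card_eq_card hsub
    rw [Finset.card_image_of_injective _ hxinj, hLcard] at h1
    simpa using h1
  have hpar : ∀ {v w}, v ∈ S → v ≠ b → w ∈ S → w ≠ b → (H.neighborSet (p v)).ncard = 2 →
      p v = p w → v = w := fun hv hvb hw hwb hd =>
    hr.eq_of_parent_eq hv hvb hw hwb (hdegb hd) hd
  have hPcard : (W.image p).card = W.card := Finset.card_image_of_injOn fun v hv w hw hvw =>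
    hpar (hWmem hv).2.1 (hWmem hv).2.2.1 (hWmem hw).2.1 (hWmem hw).2.2.1 (hWmem hv).2.2.2.1 hvw
  have h₁card : (A₁.image p).card = A₁.card := Finset.card_image_of_injOn fun v hv w hw hvw =>
    hpar (h₁ hv).1 (h₁ hv).2.1 (h₁ hw).1 (h₁ hw).2.1 (h₁ hv).2.2.2.1 hvw
  have hpp : ∀ {v w}, v ∈ A₁ → w ∈ S → w ≠ b → p (p v) = p w → p v = w := by
    intro v w hv hw hwb hvw
    obtain ⟨g1, g2, -, g3, g4, -⟩ := h₁ hv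
    exact hpar (hr.parent_mem g1 g2) (hdegb g3) hw hwb g4 hvw
  have h₂card : (A₂.image (p ∘ p)).card = A₂.card := by
    refine Finset.card_image_of_injOn fun v hv w hw hvw => ?_
    obtain ⟨g1, g2, -, g3, -⟩ := h₁ (h₂ hv).1
    obtain ⟨f1, f2, -, f3, -⟩ := h₁ (h₂ hw).1
    exact hpar g1 g2 f1 f2 g3 (hpp (h₂ hv).1 (hr.parent_mem f1 f2) (hdegb f3) hvw)
  -- The sets `A₀`, `p(A₁)`, `p²(A₂)`, `L` and `p(W)` turn out to be pairwise disjoint subsets of `S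
  -- \ {b}`. Parents of degree two have a unique child, so equal images pull back to equal vertices.
  have hd01 : Disjoint A₀ (A₁.image p) := by
    refine Finset.disjoint_right.2 fun v hv => ?_
    obtain ⟨w, hw, rfl⟩ := Finset.mem_image.1 hv
    exact (h₁ hw).2.2.2.2.2.1
  have hd02 : Disjoint (A₀ ∪ A₁.image p) (A₂.image (p ∘ p)) := by
    refine Finset.disjoint_right.2 fun v hv hc => ?_
    obtain ⟨w, hw, rfl⟩ := Finset.mem_image.1 hv
    rcases Finset.mem_union.1 hc with hc | hc
    · exact (h₁ (h₂ hw).1).2.2.2.2.2.2 hc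
    · obtain ⟨u, hu, hup⟩ := Finset.mem_image.1 hc
      have := hpp (h₂ hw).1 (h₁ hu).1 (h₁ hu).2.1 hup.symm
      exact (h₂ hw).2 (this ▸ hu)
  have hLP : Disjoint L (W.image p) := by
    refine Finset.disjoint_right.2 fun v hv hc => ?_
    obtain ⟨w, hw, rfl⟩ := Finset.mem_image.1 hv
    exact hdegL (hWmem hw).2.2.2.1 (by simpa [hLdef] using hc)
  have hd : Disjoint ((A₀ ∪ A₁.image p) ∪ A₂.image (p ∘ p)) (L ∪ W.image p) := by
    refine Finset.disjoint_left.2 fun v hv hc => ?_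
    have hc' : v ∈ H.leafSet ∨ ∃ w ∈ W, p w = v := by
      simpa [hLdef, Finset.mem_union] using hc
    rw [Finset.mem_union, Finset.mem_union] at hv
    rcases hv with (hv | hv) | hv
    · rw [hA₀, Finset.mem_filter] at hv
      rcases hc' with hc' | ⟨w, hw, rfl⟩
      · exact hind (hxL _) hc' hv.2
      · exact (hWmem hw).2.2.2.2 _ hv.2
    · obtain ⟨u, hu, rfl⟩ := Finset.mem_image.1 hv
      obtain ⟨g1, g2, g3, g4, -⟩ := h₁ hu
      rcases hc' with hc' | ⟨w, hw, hwu⟩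
      · exact hdegL g4 hc'
      · have := hpar g1 g2 (hWmem hw).2.1 (hWmem hw).2.2.1 g4 hwu.symm
        exact g3 (this ▸ (hWmem hw).1)
    · obtain ⟨u, hu, rfl⟩ := Finset.mem_image.1 hv
      obtain ⟨g1, g2, g3, g4, g5, -⟩ := h₁ (h₂ hu).1
      rcases hc' with hc' | ⟨w, hw, hwu⟩
      · exact hdegL g5 hc'
      · have := hpp (h₂ hu).1 (hWmem hw).2.1 (hWmem hw).2.2.1 hwu.symm
        exact hdegL g4 (this ▸ (hWmem hw).1)
  have hsubF : ((A₀ ∪ A₁.image p) ∪ A₂.image (p ∘ p)) ∪ (L ∪ W.image p) ⊆ F := by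
    intro v hv
    simp only [Finset.mem_union, Finset.mem_image] at hv
    rcases hv with ((hv | ⟨u, hu, rfl⟩) | ⟨u, hu, rfl⟩) | (hv | ⟨w, hw, rfl⟩)
    · exact (Finset.mem_filter.1 hv).1
    · obtain ⟨g1, g2, g3, g4, -⟩ := h₁ hu
      exact hFmem.2 ⟨hdegb g4, hr.parent_mem g1 g2⟩
    · obtain ⟨g1, g2, g3, g4, g5, -⟩ := h₁ (h₂ hu).1
      exact hFmem.2 ⟨hdegb g5, hr.parent_mem (hr.parent_mem g1 g2) (hdegb g4)⟩
    · have hv' : v ∈ H.leafSet := by simpa [hLdef] using hv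
      exact hFmem.2 ⟨by rintro rfl; exact hbL hv', h.mem_of_mem_leafSet hv'⟩
    · obtain ⟨-, g1, g2, g3, -⟩ := hWmem hw
      exact hFmem.2 ⟨hdegb g3, hr.parent_mem g1 g2⟩
  have hFcard : F.card + 1 = S.ncard := by
    rw [hF, Finset.card_erase_add_one (by simpa using hbS), Set.ncard_eq_toFinset_card']
  -- This reads `|A₀| + |A₁| + |A₂| + (k + 1) + (k - 2) ≤ |S| - 1`.
  have htotal := Finset.card_le_card hsubF
  rw [Finset.card_union_of_disjoint hd, Finset.card_union_of_disjoint hd02,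
    Finset.card_union_of_disjoint hd01, Finset.card_union_of_disjoint hLP, h₁card, h₂card, hPcard,
    hLcard] at htotal
  refine ⟨x, hxinj, hxL, ?_⟩
  have hN : ∀ i, (G.neighborSet (x i)).ncard = ∑ v ∈ S.toFinset, if G.Adj (x i) v then 1 else 0 := by
    intro i
    rw [← Finset.card_filter, ← Set.ncard_coe_finset]
    congr 1
    ext v
    simp only [mem_neighborSet, Finset.coe_filter, Set.mem_toFinset, Set.mem_ofPred_eq]
    exact ⟨fun hv => ⟨hG.neighborSet_leaf_subset hHG h hL ht (hxL i) hv, hv⟩, fun hv => hv.2⟩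
  have hsum : ∑ i, (G.neighborSet (x i)).ncard ≤ A₀.card + A₁.card + A₂.card + 3 := by
    simp only [hN]
    rw [Finset.sum_comm, ← Finset.sum_erase_add _ _ (show b ∈ S.toFinset by simpa using hbS)]
    refine Nat.add_le_add ?_ ?_
    · rw [hA₀, hA₁, hA₂, Finset.card_filter, Finset.card_filter, Finset.card_filter,
        ← Finset.sum_add_distrib, ← Finset.sum_add_distrib]
      exact Finset.sum_le_sum fun v _ => sum_ite_fin_three_le (fun j => G.Adj (x j) v) _
    · refine (Finset.sum_le_card_nsmul _ _ 1 fun i _ => ?_).trans (by simp)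
      split_ifs <;> simp
  omega

end Counting
end SimpleGraph

namespace SimpleGraph

/-! ### From subgraphs to trees on a vertex set, and the proof of (1) -/

section Dominating

variable {V : Type*} {G H : SimpleGraph V} {S : Set V} {k : ℕ}

lemma IsTreeOn.induce_isTree (h : H.IsTreeOn S) : (H.induce S).IsTree := by
  classical
  have : Nonempty S := h.nonempty.to_subtype
  refine ⟨⟨?_⟩, h.acyclic.induce S⟩
  rintro ⟨a, ha⟩ ⟨b, hb⟩
  obtain ⟨p⟩ := h.reachable ha hb
  exact ⟨p.induce S fun v hv => h.mem_of_reachable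
    (((p.takeUntil _ hv).reachable).symm) ha⟩

/-- The subgraph of `G` formed by a tree `H ≤ G` on `S`. -/
def IsTreeOn.toSubgraph (h : H.IsTreeOn S) (hHG : H ≤ G) : G.Subgraph where
  verts := S
  Adj := H.Adj
  adj_sub hab := hHG hab
  edge_vert hab := h.mem_of_adj hab
  symm := H.symm

lemma IsTreeOn.isKEndedTree_toSubgraph [Finite V] (h : H.IsTreeOn S) (hHG : H ≤ G)
    (hk : H.leafSet.ncard ≤ k) : (h.toSubgraph hHG).IsKEndedTree k :=
  ⟨h.induce_isTree, (Set.ncard_le_ncard (t := H.leafSet) fun _ hv => hv.2).trans hk⟩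

/-- A walk starting in `T.verts` never leaves it, so a cycle of the spanning graph would be a cycle
of `T.coe`. -/
lemma Subgraph.isTreeOn_spanningCoe {T : G.Subgraph} (hT : T.coe.IsTree) :
    T.spanningCoe.IsTreeOn T.verts := by
  have hmem : ∀ {a b}, T.spanningCoe.Adj a b → a ∈ T.verts := fun hab => T.edge_vert hab
  have hsupp : ∀ {a b} (p : T.spanningCoe.Walk a b), a ∈ T.verts → ∀ v ∈ p.support, v ∈ T.verts := by
    intro a b p
    induction p with
    | nil => intro ha v hv; simp at hv; exact hv ▸ ha
    | cons hadj p ih =>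
      intro ha v hv
      rcases List.mem_cons.1 hv with rfl | hv
      · exact ha
      · exact ih (hmem hadj.symm) v hv
  refine ⟨?_, hmem, ?_, ?_⟩
  · intro v c hc
    have hv : v ∈ T.verts := by
      cases c with
      | nil => exact absurd rfl hc.ne_nil
      | cons hadj _ => exact hmem hadj
    refine hT.isAcyclic (c.induce T.verts (hsupp c hv)) ?_
    rw [← Walk.map_induce c (hsupp c hv)] at hc
    exact hc.of_map
  · intro a b ha hb
    have := hT.connected.preconnected ⟨a, ha⟩ ⟨b, hb⟩
    exact this.map (⟨Subtype.val, fun h => h⟩ : T.coe →g T.spanningCoe)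
  · obtain ⟨v⟩ := hT.connected.nonempty
    exact ⟨v, v.2⟩

lemma Subgraph.leafSet_spanningCoe (T : G.Subgraph) : T.spanningCoe.leafSet = T.endVerts := by
  ext v
  refine ⟨fun hv => ⟨?_, hv⟩, fun hv => hv.2⟩
  obtain ⟨n, hn⟩ := exists_adj_of_mem_leafSet hv
  exact T.edge_vert hn

lemma bddAbove_ncard_isKEndedTree [Finite V] (G : SimpleGraph V) (k : ℕ) :
    BddAbove {n : ℕ | ∃ T : G.Subgraph, T.IsKEndedTree k ∧ T.verts.ncard = n} := by
  refine ⟨Nat.card V, ?_⟩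
  rintro n ⟨T, -, rfl⟩
  exact Set.ncard_le_card _

lemma IsTreeOn.ncard_le_largestKEndedTree [Finite V] (h : H.IsTreeOn S) (hHG : H ≤ G)
    (hk : H.leafSet.ncard ≤ k) : S.ncard ≤ G.largestKEndedTree k :=
  le_csSup (bddAbove_ncard_isKEndedTree G k)
    ⟨h.toSubgraph hHG, h.isKEndedTree_toSubgraph hHG hk, rfl⟩

lemma exists_isKEndedTree_ncard_eq [Finite V] [Nonempty V] (G : SimpleGraph V) (k : ℕ) :
    ∃ T : G.Subgraph, T.IsKEndedTree k ∧ T.verts.ncard = G.largestKEndedTree k := by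
  refine Nat.sSup_mem ?_ (bddAbove_ncard_isKEndedTree G k)
  obtain ⟨v⟩ := ‹Nonempty V›
  have h : (⊥ : SimpleGraph V).IsTreeOn {v} :=
    ⟨isAcyclic_bot, fun hab => hab.elim, by rintro a b rfl rfl; rfl, ⟨v, rfl⟩⟩
  refine ⟨_, h.toSubgraph bot_le, h.isKEndedTree_toSubgraph bot_le ?_, rfl⟩
  have : (⊥ : SimpleGraph V).leafSet = ∅ := by
    refine Set.eq_empty_of_forall_notMem fun v hv => ?_
    obtain ⟨n, hn⟩ := exists_adj_of_mem_leafSet hv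
    exact hn
  simp [this]

/-- An edge outside `S` yields, in a connected graph, a path of length two leaving `S`. -/
lemma Connected.exists_adj_adj_notMem (hG : G.Connected) (hS : S.Nonempty) {a c : V} (ha : a ∉ S)
    (hc : c ∉ S) (hac : G.Adj a c) : ∃ x ∈ S, ∃ y ∉ S, ∃ z ∉ S, G.Adj x y ∧ G.Adj y z := by
  obtain ⟨s, hs⟩ := hS
  obtain ⟨p⟩ := hG.preconnected a s
  induction p generalizing c with
  | nil => exact absurd hs ha
  | @cons a a' _ hadj p ih =>
    by_cases ha' : a' ∈ S
    · exact ⟨a', ha', a, ha, c, hc, hadj.symm, hac⟩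
    · exact ih ha' ha hadj.symm hs

/-- A `k`-ended tree is not dominating, so an edge lies outside it. Connectivity turns this edge
into a path of length two leaving the tree, whose addition yields a `(k + 1)`-ended tree with two
more vertices; `k ≥ 2` covers the one-vertex tree. -/
lemma Connected.hasLeafGap [Finite V] (hG : G.Connected) (hk : 2 ≤ k)
    (hno : ¬ ∃ T : G.Subgraph, T.IsKEndedTree k ∧ T.IsDominatingSubgraph) :
    G.HasLeafGap k (G.largestKEndedTree (k + 1)) := by
  refine ⟨hk, fun hHG h hL => h.ncard_le_largestKEndedTree hHG hL, fun {H S} hHG h hL => ?_⟩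
  have hnd : ¬ (h.toSubgraph hHG).IsDominatingSubgraph := fun hd =>
    hno ⟨_, h.isKEndedTree_toSubgraph hHG hL, hd⟩
  obtain ⟨a, ha, c, hc, hac⟩ : ∃ a, a ∉ S ∧ ∃ c, c ∉ S ∧ G.Adj a c := by
    by_contra! hcon
    exact hnd fun a ha c hc _ => hcon a ha c hc
  obtain ⟨x, hx, y, hy, z, hz, hxy, hyz⟩ := hG.exists_adj_adj_notMem h.nonempty ha hc hac
  obtain ⟨h1, h2⟩ := h.add_path hx hy hz hyz.ne
  have h3 := h1.ncard_le_largestKEndedTree (G := G) (k := k + 1)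
    (sup_le (sup_le hHG (by rwa [edge_le_iff, or_iff_right hxy.ne]))
      (by rwa [edge_le_iff, or_iff_right hyz.ne])) (by omega)
  rwa [Set.ncard_insert_of_notMem (by simp [hyz.ne', hz]), Set.ncard_insert_of_notMem hy] at h3

theorem Connected.exists_dominating_isKEndedTree [Fintype V] [DecidableRel G.Adj]
    (hG : G.Connected) (hk : 2 ≤ k)
    (hσ : (G.largestKEndedTree (k + 1) : ℕ∞) + 4 ≤ G.sigma 3 + 2 * (k : ℕ∞)) :
    ∃ T : G.Subgraph, T.IsKEndedTree k ∧ T.IsDominatingSubgraph := by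
  classical
  by_contra hno
  have hgap := hG.hasLeafGap hk hno
  have := hG.nonempty
  obtain ⟨T, hT, hTcard⟩ := exists_isKEndedTree_ncard_eq G (k + 1)
  have h := Subgraph.isTreeOn_spanningCoe hT.1
  have hL : T.spanningCoe.leafSet.ncard ≤ k + 1 := by rw [T.leafSet_spanningCoe]; exact hT.2
  have hle : T.spanningCoe ≤ G := T.spanningCoe_le
  obtain ⟨x, hinj, hx, hsum⟩ := hgap.exists_leaves_sum_degree_le hle h hL hTcard.ge
  have hset : G.IsNIndepSet 3 (Finset.univ.map ⟨x, hinj⟩) := by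
    refine ⟨?_, by simp⟩
    intro a ha b hb _
    simp only [Finset.coe_map, Function.Embedding.coeFn_mk, Finset.coe_univ, Set.image_univ,
      Set.mem_range] at ha hb
    obtain ⟨i, rfl⟩ := ha
    obtain ⟨j, rfl⟩ := hb
    exact hgap.not_adj_of_mem_leafSet hle h hL (by omega) (hx i) (hx j)
  have hdeg : ∀ v, (G.neighborSet v).ncard = G.degree v := fun v => by
    rw [← Nat.card_coe_set_eq, Nat.card_eq_fintype_card, card_neighborSet_eq_degree]
  have h1 : G.sigma 3 ≤ ((∑ i, (G.neighborSet (x i)).ncard : ℕ) : ℕ∞) := by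
    refine (iInf_le _ (⟨_, hset⟩ : {S : Finset V // G.IsNIndepSet 3 S})).trans ?_
    simp [Finset.sum_map, hdeg]
  have h2 := hσ.trans (add_le_add_left h1 _)
  have h3 : G.largestKEndedTree (k + 1) + 4 ≤ ∑ i, (G.neighborSet (x i)).ncard + 2 * k := by
    exact_mod_cast h2
  omega

end Dominating
end SimpleGraph

namespace SimpleGraph

/-! ### The extremal graphs of (2) -/

section Sharpness

open Sum

lemma IsTreeOn.sum_ncard_neighborSet {V : Type*} [Fintype V] {H : SimpleGraph V} {S : Set V}
    (h : H.IsTreeOn S) : ∑ v, (H.neighborSet v).ncard + 2 = 2 * S.ncard := by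
  classical
  have hE := h.induce_isTree.card_edgeFinset
  have hsum := (H.induce S).sum_degrees_eq_twice_card_edges
  have hdeg : ∀ v : S, (H.induce S).degree v = (H.neighborSet v).ncard := by
    intro v
    rw [← card_neighborSet_eq_degree, ← Nat.card_eq_fintype_card, Nat.card_coe_set_eq,
      ← Set.ncard_image_of_injective _ Subtype.val_injective]
    congr 1
    ext w
    simp only [Set.mem_image, mem_neighborSet, comap_adj, Function.Embedding.subtype_apply,
      Subtype.exists, exists_and_left, exists_prop]
    exact ⟨fun ⟨a, h1, h2, h3⟩ => h3 ▸ h1, fun hw => ⟨w, hw, h.mem_of_adj_right hw, rfl⟩⟩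
  have hout : ∑ v, (H.neighborSet v).ncard = ∑ v : S, (H.neighborSet v).ncard := by
    rw [← Finset.sum_subtype (p := (· ∈ S)) S.toFinset (by simp)
      (fun v => (H.neighborSet v).ncard)]
    refine (Finset.sum_subset (Finset.subset_univ _) fun v _ hv => ?_).symm
    rw [Set.ncard_eq_zero]
    exact Set.eq_empty_of_forall_notMem fun w hw => hv (by simpa using h.mem_of_adj hw)
  simp only [hdeg] at hsum
  rw [hout, hsum, Set.ncard_eq_toFinset_card', Set.toFinset_card, ← hE]
  ring

variable {m s r : ℕ}

@[simp] lemma edgesJoinClique_adj_inl_inl {p q : Fin m × Fin 2} :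
    (edgesJoinClique m s).Adj (inl p) (inl q) ↔ p ≠ q ∧ p.1 = q.1 := by
  refine and_congr inl_injective.ne_iff ⟨fun h => h p q rfl rfl, ?_⟩
  rintro h _ _ ⟨⟩ ⟨⟩
  exact h

@[simp] lemma edgesJoinClique_adj_inl_inr {p : Fin m × Fin 2} {w : Fin s} :
    (edgesJoinClique m s).Adj (inl p) (inr w) := by
  simp [edgesJoinClique]

@[simp] lemma edgesJoinClique_adj_inr {w : Fin s} {v : (Fin m × Fin 2) ⊕ Fin s} :
    (edgesJoinClique m s).Adj (inr w) v ↔ inr w ≠ v := by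
  simp [edgesJoinClique]

/-- Here `Q` is the set of copies of `K₂` met by the tree. Non-leaves have degree at least two while
a copy supplies at most one tree edge, so every copy met forces edges to the clique, up to the
allowance for leaves; the handshake identity bounds the total. -/
lemma IsTreeOn.card_touched_le {H : SimpleGraph ((Fin m × Fin 2) ⊕ Fin s)}
    {S : Set ((Fin m × Fin 2) ⊕ Fin s)} (h : H.IsTreeOn S) (hH : H ≤ edgesJoinClique m s)
    (hr : 2 ≤ r) (hs : 1 ≤ s) (hL : H.leafSet.ncard ≤ r) {Q : Finset (Fin m)}
    (hQ : ∀ i, i ∈ Q ↔ ∃ e, inl (i, e) ∈ S) : Q.card + 1 ≤ s + r ∧ S.ncard ≤ s + 2 * Q.card := by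
  classical
  have hScard : S.ncard = ∑ v, if v ∈ S then 1 else 0 := by
    rw [← Finset.card_filter, ← Set.ncard_coe_finset]
    simp
  rw [Fintype.sum_sum_type, Fintype.sum_prod_type] at hScard
  have hQ' : ∀ i, i ∈ Q ↔ inl (i, 0) ∈ S ∨ inl (i, 1) ∈ S := fun i => by
    rw [hQ, Fin.exists_fin_two]
  have hQcard : Q.card = ∑ i, if i ∈ Q then 1 else 0 := by simp
  have hK : (∑ w : Fin s, if inr w ∈ S then 1 else 0) ≤ s :=
    (Finset.sum_le_card_nsmul _ _ 1 fun i _ => by split_ifs <;> simp).trans (by simp)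
  have hn : ∀ i, (∑ e, if inl (i, e) ∈ S then 1 else 0) ≤ 2 * if i ∈ Q then 1 else 0 := by
    intro i
    rw [Fin.sum_univ_two]
    by_cases h0 : inl (i, 0) ∈ S <;> by_cases h1 : inl (i, 1) ∈ S <;> simp [hQ', h0, h1]
  have hN := Finset.sum_le_sum fun i (_ : i ∈ Finset.univ) => hn i
  rw [← Finset.mul_sum, ← hQcard] at hN
  refine ⟨?_, by omega⟩
  -- A one-vertex tree has a vertex of degree zero, which breaks the lower bound on degrees used
  -- below.
  by_cases hiso : ∃ v ∈ S, H.neighborSet v = ∅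
  · obtain ⟨v, hv, hvN⟩ := hiso
    have hSv : ∀ u ∈ S, u = v := by
      intro u hu
      obtain ⟨P⟩ := h.reachable hv hu
      cases P with
      | nil => rfl
      | @cons _ w _ hadj _ =>
        have hw : w ∈ H.neighborSet v := hadj
        simp [hvN] at hw
    have : Q.card ≤ 1 := Finset.card_le_one.2 fun i hi j hj => by
      obtain ⟨e, he⟩ := (hQ i).1 hi
      obtain ⟨f, hf⟩ := (hQ j).1 hj
      have := (hSv _ he).trans (hSv _ hf).symm
      simpa using (congrArg Prod.fst (inl_injective this))
    omega
  have hdeg : ∀ v, (H.neighborSet v).ncard = ∑ u, if H.Adj v u then 1 else 0 := by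
    intro v
    rw [← Finset.card_filter, ← Set.ncard_coe_finset]
    congr 1
    ext u
    simp
  have hhand := h.sum_ncard_neighborSet
  rw [hScard, Fintype.sum_sum_type, Fintype.sum_prod_type] at hhand
  -- leaves
  have hleaf : ∀ v, 2 * (if v ∈ S then 1 else 0) ≤
      (H.neighborSet v).ncard + if v ∈ H.leafSet then 1 else 0 := by
    intro v
    by_cases hv : v ∈ S
    · have h0 : (H.neighborSet v).ncard ≠ 0 := by
        rw [Ne, Set.ncard_eq_zero]
        exact fun hc => hiso ⟨v, hv, hc⟩
      by_cases hvL : v ∈ H.leafSet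
      · simp only [hv, hvL, if_true]; omega
      · have : (H.neighborSet v).ncard ≠ 1 := hvL
        simp only [hv, hvL, if_true, if_false]; omega
    · simp [hv]
  have hLcard : H.leafSet.ncard = ∑ v, if v ∈ H.leafSet then 1 else 0 := by
    rw [← Finset.card_filter, ← Set.ncard_coe_finset]
    simp
  rw [Fintype.sum_sum_type, Fintype.sum_prod_type] at hLcard
  have hleafI := Finset.sum_le_sum fun i (_ : i ∈ Finset.univ) =>
    Finset.sum_le_sum fun e (_ : e ∈ Finset.univ) => hleaf (inl (i, e))
  simp only [Finset.sum_add_distrib, ← Finset.mul_sum] at hleafI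
  -- edges inside the copies of `K₂`, and edges meeting the clique
  have hin : ∀ i, (∑ e, ∑ q, if H.Adj (inl (i, e)) (inl q) then 1 else 0) +
      2 * (if i ∈ Q then 1 else 0) ≤ 2 * ∑ e, if inl (i, e) ∈ S then 1 else 0 := by
    intro i
    have hsum : ∀ e e' : Fin 2, e' ≠ e → (∑ q, if H.Adj (inl (i, e)) (inl q) then 1 else 0) =
        if H.Adj (inl (i, e)) (inl (i, e')) then 1 else 0 := by
      intro e e' hee'
      refine Finset.sum_eq_single (i, e') (fun q _ hq => if_neg fun hadj => hq ?_) (by simp)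
      have h1 := edgesJoinClique_adj_inl_inl.1 (hH hadj)
      obtain ⟨j, f⟩ := q
      obtain ⟨h2, rfl : i = j⟩ := h1
      have : f ≠ e := by rintro rfl; exact h2 rfl
      congr 1
      omega
    rw [Fin.sum_univ_two, Fin.sum_univ_two, hsum 0 1 (by simp), hsum 1 0 (by simp)]
    by_cases hadj : H.Adj (inl (i, 0)) (inl (i, 1))
    · simp [hQ', hadj, hadj.symm, h.mem_of_adj hadj, h.mem_of_adj_right hadj]
    · have hadj' : ¬ H.Adj (inl (i, 1)) (inl (i, 0)) := fun hc => hadj hc.symm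
      by_cases h0 : inl (i, 0) ∈ S <;> by_cases h1 : inl (i, 1) ∈ S <;> simp [hQ', h0, h1, hadj, hadj']
  have hinsum := Finset.sum_le_sum fun i (_ : i ∈ Finset.univ) => hin i
  rw [Finset.sum_add_distrib, ← Finset.mul_sum, ← Finset.mul_sum, ← hQcard] at hinsum
  have hcross : (∑ i, ∑ e, ∑ w, if H.Adj (inl (i, e)) (inr w) then 1 else 0) ≤
      ∑ w, (H.neighborSet (inr w)).ncard := by
    rw [← Fintype.sum_prod_type (f := fun p : Fin m × Fin 2 =>
      ∑ w, if H.Adj (inl p) (inr w) then 1 else 0), Finset.sum_comm]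
    refine Finset.sum_le_sum fun w _ => ?_
    rw [hdeg, Fintype.sum_sum_type]
    simp only [H.adj_comm (inr w)]
    exact Nat.le_add_right _ _
  have hsplit : (∑ i, ∑ e, (H.neighborSet (inl (i, e))).ncard) =
      (∑ i, ∑ e, ∑ q, if H.Adj (inl (i, e)) (inl q) then 1 else 0) +
      ∑ i, ∑ e, ∑ w, if H.Adj (inl (i, e)) (inr w) then 1 else 0 := by
    simp only [hdeg, Fintype.sum_sum_type, Finset.sum_add_distrib]
  -- Let `N` and `K` count the tree vertices in the copies and in the clique. The degree sum over
  -- the copies is at least `2N - r`, and at most `2N - 2|Q|` of it is internal, so the clique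
  -- degrees sum to at least `2|Q| - r`. The total is `2(N + K) - 2`, whence `|Q| ≤ K + r - 1`.
  omega

lemma degree_edgesJoinClique_inl (p : Fin m × Fin 2) :
    (edgesJoinClique m s).degree (inl p) = s + 1 := by
  classical
  rw [← card_neighborFinset_eq_degree, neighborFinset_eq_filter, Finset.card_filter,
    Fintype.sum_sum_type]
  have : (∑ q, if (edgesJoinClique m s).Adj (inl p) (inl q) then 1 else 0) = 1 := by
    rw [Finset.sum_eq_single (p.1, p.2 + 1)]
    · rw [if_pos]
      simp [Prod.ext_iff]
    · rintro ⟨j, f⟩ - hq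
      refine if_neg fun hadj => hq ?_
      obtain ⟨i, e⟩ := p
      obtain ⟨h2, rfl : i = j⟩ := edgesJoinClique_adj_inl_inl.1 hadj
      have : f ≠ e := by rintro rfl; exact h2 rfl
      simp only [Prod.mk.injEq, true_and]
      omega
    · simp
  rw [this]
  simp [add_comm]

lemma degree_edgesJoinClique_inr (w : Fin s) :
    (edgesJoinClique m s).degree (inr w) + 1 = 2 * m + s := by
  classical
  have : (edgesJoinClique m s).neighborFinset (inr w) = Finset.univ.erase (inr w) := by
    ext v
    simp [eq_comm]
  rw [← card_neighborFinset_eq_degree, this, Finset.card_erase_add_one (Finset.mem_univ _)]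
  simp [mul_comm]

lemma minDegree_edgesJoinClique (hm : 1 ≤ m) : (edgesJoinClique m s).minDegree = s + 1 := by
  have : Nonempty ((Fin m × Fin 2) ⊕ Fin s) := ⟨inl (⟨0, hm⟩, 0)⟩
  refine le_antisymm ?_ (le_minDegree_of_forall_le_degree _ _ ?_)
  · rw [← degree_edgesJoinClique_inl (m := m) (⟨0, hm⟩, 0)]
    exact minDegree_le_degree _ _
  · rintro (p | w)
    · rw [degree_edgesJoinClique_inl]
    · have := degree_edgesJoinClique_inr (m := m) w
      omega

lemma connected_edgesJoinClique (hs : 1 ≤ s) : (edgesJoinClique m s).Connected :=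
  Connected.of_isUniversal (v := inr ⟨0, hs⟩) fun v hv => by
    simpa using hv

lemma le_sigma_of_le_minDegree {V : Type*} [Fintype V] (G : SimpleGraph V) [DecidableRel G.Adj]
    (n d : ℕ) (hd : d ≤ G.minDegree) : ((n * d : ℕ) : ℕ∞) ≤ G.sigma n := by
  refine le_iInf fun A => ?_
  have := Finset.card_nsmul_le_sum A.1 (fun v => G.degree v) d
    fun v _ => hd.trans (G.minDegree_le_degree v)
  rw [A.2.card_eq, smul_eq_mul] at this
  exact_mod_cast this

lemma largestKEndedTree_edgesJoinClique_le (hr : 2 ≤ r) (hs : 1 ≤ s) :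
    (edgesJoinClique m s).largestKEndedTree r + 2 ≤ 3 * s + 2 * r := by
  classical
  have : Nonempty ((Fin m × Fin 2) ⊕ Fin s) := ⟨inr ⟨0, hs⟩⟩
  obtain ⟨T, hT, hcard⟩ := exists_isKEndedTree_ncard_eq (edgesJoinClique m s) r
  have := (Subgraph.isTreeOn_spanningCoe hT.1).card_touched_le T.spanningCoe_le hr hs
    (T.leafSet_spanningCoe ▸ hT.2)
    (Q := Finset.univ.filter fun i => ∃ e, inl (i, e) ∈ T.verts) (by simp)
  omega

lemma not_exists_dominating_edgesJoinClique (hr : 2 ≤ r) (hs : 1 ≤ s) (hm : s + r ≤ m) :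
    ¬ ∃ T : (edgesJoinClique m s).Subgraph, T.IsKEndedTree r ∧ T.IsDominatingSubgraph := by
  rintro ⟨T, hT, hdom⟩
  -- A dominating tree meets every copy, since a copy it misses is an edge outside it; so `Q` may be
  -- taken to be everything.
  have := ((Subgraph.isTreeOn_spanningCoe hT.1).card_touched_le T.spanningCoe_le hr hs
    (T.leafSet_spanningCoe ▸ hT.2) (Q := Finset.univ) fun i => by
      simp only [Finset.mem_univ, true_iff]
      by_contra! hc
      exact hdom (hc 0) (hc 1) (by simp) (by simp)).1
  rw [Finset.card_univ, Fintype.card_fin] at this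
  omega

end Sharpness
end SimpleGraph

theorem theorem3 (k : ℕ) (hk : 2 ≤ k) :
    -- The bound `σ₃ ≥ t_{k+1} - 2k + 4`, with `2k` moved to the left-hand side.
    (∀ (V : Type*) [Fintype V] (G : SimpleGraph V) [DecidableRel G.Adj],
      G.Connected →
      (G.largestKEndedTree (k + 1) : ℕ∞) + 4 ≤ G.sigma 3 + 2 * (k : ℕ∞) →
      ∃ T : G.Subgraph, T.IsKEndedTree k ∧ T.IsDominatingSubgraph) ∧
    -- Sharpness: neither `t_{k+1} - 2k + 3` nor `t_k - 2k + 4` suffices.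
    (∀ δ : ℕ, 2 ≤ δ →
      (SimpleGraph.edgesJoinClique (δ + k - 1) (δ - 1)).Connected ∧
      (SimpleGraph.edgesJoinClique (δ + k - 1) (δ - 1)).minDegree = δ ∧
      ((SimpleGraph.edgesJoinClique (δ + k - 1) (δ - 1)).largestKEndedTree (k + 1) : ℕ∞) + 3 ≤
        (SimpleGraph.edgesJoinClique (δ + k - 1) (δ - 1)).sigma 3 + 2 * (k : ℕ∞) ∧
      ((SimpleGraph.edgesJoinClique (δ + k - 1) (δ - 1)).largestKEndedTree k : ℕ∞) + 4 ≤
        (SimpleGraph.edgesJoinClique (δ + k - 1) (δ - 1)).sigma 3 + 2 * (k : ℕ∞) ∧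
      ¬ ∃ T : (SimpleGraph.edgesJoinClique (δ + k - 1) (δ - 1)).Subgraph,
        T.IsKEndedTree k ∧ T.IsDominatingSubgraph) := by
  refine ⟨fun V _ G _ hG hσ => hG.exists_dominating_isKEndedTree hk hσ, fun δ hδ => ?_⟩
  have hmin : (SimpleGraph.edgesJoinClique (δ + k - 1) (δ - 1)).minDegree = δ := by
    rw [SimpleGraph.minDegree_edgesJoinClique (by omega)]
    omega
  have hσ := SimpleGraph.le_sigma_of_le_minDegree
    (SimpleGraph.edgesJoinClique (δ + k - 1) (δ - 1)) 3 δ hmin.ge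
  refine ⟨SimpleGraph.connected_edgesJoinClique (by omega), hmin, ?_, ?_,
    SimpleGraph.not_exists_dominating_edgesJoinClique hk (by omega) (by omega)⟩
  -- With `s = δ - 1` the bound is `t_{k+1} ≤ 3δ + 2k - 3`, and `σ₃ ≥ 3δ`: exactly enough. For `t_k`
  -- below, the bound `3δ + 2k - 5` leaves one to spare.
  · have h := SimpleGraph.largestKEndedTree_edgesJoinClique_le (m := δ + k - 1) (s := δ - 1)
      (r := k + 1) (by omega) (by omega)
    refine le_trans ?_ (add_le_add_left hσ _)
    norm_cast
    omega
  · have h := SimpleGraph.largestKEndedTree_edgesJoinClique_le (m := δ + k - 1) (s := δ - 1)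
      (r := k) hk (by omega)
    refine le_trans ?_ (add_le_add_left hσ _)
    norm_cast
    omega
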